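/- Let $M$ be a transitive model of ZFC (a transitive set or class $M$ such that $(M,\in)$ satisfies ZFC). All structures, isomorphisms, automorphism groups and maps below are taken in $M$, i.e. they are elements of $M$; "formula" means formula of set theory, possibly with parameters from $M$. A *construction* in $M$ consists of formulas $\phi_1(x),\phi_2(x),\phi_3(x)$ such that: $\phi_1,\phi_2$ define in $M$ first-order languages $L$ and $L^-$ with $L^-\subseteq L$, where $L\setminus L^-$ contains a designated 1-ary relation symbol $P$; the class $\{a\in M: M\models\phi_3(a)\}$, called the *graph*, is a class of $L$-structures; for every $B$ in the graph, $P^B$ is the domain of an $L^-$-structure $B^-$ inside $B$ (the class of all these $B^-$ is the *domain* of the construction); the domain is closed under isomorphism of $L^-$-structures; and for all $A,B$ in the graph, every isomorphism from $A^-$ onto $B^-$ extends to an isomorphism from $A$ onto $B$. A construction is *rigid-based* if no $B^-$, for $B$ in its graph, has a nontrivial automorphism; *unitype* if its domain contains exactly one isomorphism type; *uniformisable* if there is a formula $\phi_4(x,y)$ such that for every $A$ in the domain there is a unique $B$ with $M\models\phi_4(A,B)$, and this $B$ is in the graph and $B^-=A$. For $B$ in the graph let $\nu_B:\mathrm{Aut}(B)\to\mathrm{Aut}(B^-)$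 be the restriction homomorphism. A *splitting* of a surjective group homomorphism $\nu:G\to H$ is a homomorphism $s:H\to G$ with $\nu s=\mathrm{id}_H$. A *weak splitting* of $\nu$ is a map $s:H\to G$ with $\nu s=\mathrm{id}_H$ for which there is a commutative subgroup $G_0$ of $G$ such that, whenever $f_1,\dots,f_k\in H$, $\varepsilon_i\in\{1,-1\}$ and $f_1^{\varepsilon_1}\cdots f_k^{\varepsilon_k}=1$, we have $s(f_1)^{\varepsilon_1}\cdots s(f_k)^{\varepsilon_k}\in G_0$. A construction is *natural* (respectively *weakly natural*) if for every $B$ in its graph $\nu_B$ has a splitting (respectively a weak splitting). **Theorem.** There is no transitive model $M$ of ZFC in which both of the following hold: (a) every rigid-based construction in $M$ is uniformisable; (b) every unitype uniformisable construction in $M$ is weakly natural. In particular, there is no transitive model of ZFC in which the natural constructions are exactly the uniformisable ones. -/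

import Mathlib

open FirstOrder

universe u

namespace NatDef

/-! ### The language of set theory and transitive models of ZFC -/

/-- The only symbol of the language of set theory: a binary relation symbol for membership. -/
inductive MemRel : ℕ → Type
  | mem : MemRel 2

/-- The first-order language of set theory. -/
def setLang : FirstOrder.Language.{0, 0} := ⟨fun _ => Empty, MemRel⟩

/-- Every class `M` of sets is read as the structure `(M, ∈)`. -/
instance (M : Set ZFSet.{u}) : setLang.Structure M where
  funMap f _ := nomatch f
  RelMap {_} r v := match r, v with
    | MemRel.mem, v => (v 0 : ZFSet.{u}) ∈ (v 1 : ZFSet.{u})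

/-- Formulas of set theory with parameters from `M`, with `n` free variables. -/
abbrev ParamFormula (M : Set ZFSet.{u}) (n : ℕ) : Type (u + 1) :=
  (setLang[[M]]).Formula (Fin n)

/-- `x` lies in `M` and `M ⊨ φ(x)`. -/
def Holds₁ {M : Set ZFSet.{u}} (φ : ParamFormula M 1) (x : ZFSet.{u}) : Prop :=
  ∃ hx : x ∈ M, φ.Realize ![(⟨x, hx⟩ : M)]

/-- `x` and `y` lie in `M` and `M ⊨ φ(x, y)`. -/
def Holds₂ {M : Set ZFSet.{u}} (φ : ParamFormula M 2) (x y : ZFSet.{u}) : Prop :=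
  ∃ (hx : x ∈ M) (hy : y ∈ M), φ.Realize ![(⟨x, hx⟩ : M), ⟨y, hy⟩]

/-- `M` is a transitive class (possibly a set) and `(M, ∈)` satisfies the axioms of ZFC.
Separation and replacement are schemata over first-order formulas with parameters from `M`. -/
structure IsTransitiveModelZFC (M : Set ZFSet.{u}) : Prop where
  transitive : ∀ x ∈ M, ∀ y ∈ x, y ∈ M
  extensionality : ∀ x ∈ M, ∀ y ∈ M, (∀ z ∈ M, z ∈ x ↔ z ∈ y) → x = y
  foundation : ∀ x ∈ M, (∃ y ∈ M, y ∈ x) → ∃ y ∈ M, y ∈ x ∧ ∀ z ∈ M, z ∈ y → z ∉ x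
  pairing : ∀ x ∈ M, ∀ y ∈ M, ∃ z ∈ M, ∀ w ∈ M, w ∈ z ↔ w = x ∨ w = y
  union : ∀ x ∈ M, ∃ y ∈ M, ∀ z ∈ M, z ∈ y ↔ ∃ w ∈ M, w ∈ x ∧ z ∈ w
  powerset : ∀ x ∈ M, ∃ y ∈ M, ∀ z ∈ M, z ∈ y ↔ ∀ w ∈ M, w ∈ z → w ∈ x
  infinity : ∃ x ∈ M, (∃ e ∈ M, e ∈ x ∧ ∀ z ∈ M, z ∉ e) ∧
    ∀ y ∈ M, y ∈ x → ∃ s ∈ M, s ∈ x ∧ ∀ z ∈ M, z ∈ s ↔ z ∈ y ∨ z = y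
  separation : ∀ φ : ParamFormula M 1, ∀ x ∈ M,
    ∃ y ∈ M, ∀ z ∈ M, z ∈ y ↔ z ∈ x ∧ Holds₁ φ z
  replacement : ∀ φ : ParamFormula M 2, ∀ x ∈ M,
    (∀ a ∈ M, a ∈ x → ∃! b, b ∈ M ∧ Holds₂ φ a b) →
    ∃ y ∈ M, ∀ b ∈ M, b ∈ y ↔ ∃ a ∈ M, a ∈ x ∧ Holds₂ φ a b
  choice : ∀ x ∈ M, (∀ y ∈ M, y ∈ x → ∃ z ∈ M, z ∈ y) →
    (∀ y ∈ M, ∀ y' ∈ M, y ∈ x → y' ∈ x → (∃ z ∈ M, z ∈ y ∧ z ∈ y') → y = y') →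
    ∃ c ∈ M, ∀ y ∈ M, y ∈ x → ∃! z, z ∈ M ∧ z ∈ y ∧ z ∈ c

/-! ### Relations and functions as sets of ordered pairs -/

/-- `g ∘ f`, for sets of ordered pairs. -/
def comp (g f : ZFSet.{u}) : ZFSet.{u} :=
  ZFSet.sep (fun p => ∃ x y z, p = ZFSet.pair x z ∧ ZFSet.pair x y ∈ f ∧ ZFSet.pair y z ∈ g)
    (ZFSet.prod (ZFSet.sUnion (ZFSet.sUnion f)) (ZFSet.sUnion (ZFSet.sUnion g)))

/-- The converse of a set of ordered pairs. -/
def inv (f : ZFSet.{u}) : ZFSet.{u} :=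
  ZFSet.sep (fun p => ∃ x y, p = ZFSet.pair y x ∧ ZFSet.pair x y ∈ f)
    (ZFSet.prod (ZFSet.sUnion (ZFSet.sUnion f)) (ZFSet.sUnion (ZFSet.sUnion f)))

/-- The identity on `D`. -/
def idOn (D : ZFSet.{u}) : ZFSet.{u} :=
  ZFSet.sep (fun p => ∃ x, p = ZFSet.pair x x) (ZFSet.prod D D)

/-- The restriction of `f` to arguments in `D`. -/
def restrict (f D : ZFSet.{u}) : ZFSet.{u} :=
  ZFSet.sep (fun p => ∃ x ∈ D, ∃ y, p = ZFSet.pair x y) f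

/-- `f` is a bijection from `D` onto `E`. -/
def IsBij (D E f : ZFSet.{u}) : Prop :=
  ZFSet.IsFunc D E f ∧ ∀ y ∈ E, ∃! x, ZFSet.pair x y ∈ f

/-! ### First-order languages and structures as sets -/

/-- The relation symbol of arity `n` named `a`. -/
def relSym (n a : ZFSet.{u}) : ZFSet.{u} := ZFSet.pair ∅ (ZFSet.pair n a)

/-- The function symbol of arity `n` named `a` (a constant if `n` is `0`). -/
def funSym (n a : ZFSet.{u}) : ZFSet.{u} := ZFSet.pair {∅} (ZFSet.pair n a)

/-- A first-order language is a set of relation and function symbols, with arities in `ω`. -/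
def IsLanguage (L : ZFSet.{u}) : Prop :=
  ∀ s ∈ L, ∃ n ∈ ZFSet.omega, ∃ a, s = relSym n a ∨ s = funSym n a

/-- The raw data of a set-coded structure: a domain and a set of pairs
`(symbol, interpretation)`. -/
@[ext]
structure Str where
  dom : ZFSet.{u}
  interp : ZFSet.{u}

/-- A structure as a set. -/
def Str.code (B : Str.{u}) : ZFSet.{u} := ZFSet.pair B.dom B.interp

/-- `v` is the interpretation of the symbol `s` in `B`. -/
def Str.Interprets (B : Str.{u}) (s v : ZFSet.{u}) : Prop := ZFSet.pair s v ∈ B.interp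

/-- `B` is an `L`-structure. An `n`-tuple from `B.dom` is a function from the von Neumann
number `n` to `B.dom`. -/
structure IsStr (L : ZFSet.{u}) (B : Str.{u}) : Prop where
  nonempty : B.dom.Nonempty
  interp_subset : ∀ p ∈ B.interp, ∃ s ∈ L, ∃ v, p = ZFSet.pair s v
  interp_unique : ∀ s ∈ L, ∃! v, B.Interprets s v
  rel : ∀ n a v, relSym n a ∈ L → B.Interprets (relSym n a) v → v ⊆ ZFSet.funs n B.dom
  func : ∀ n a v, funSym n a ∈ L → B.Interprets (funSym n a) v →
    ZFSet.IsFunc (ZFSet.funs n B.dom) B.dom v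

/-- `f` is an isomorphism of `L`-structures from `A` onto `B`. For an `n`-tuple `t`, the tuple
of the images of its entries is `comp f t`. -/
structure IsIso (L : ZFSet.{u}) (A B : Str.{u}) (f : ZFSet.{u}) : Prop where
  bij : IsBij A.dom B.dom f
  rel : ∀ n a v w, relSym n a ∈ L → A.Interprets (relSym n a) v → B.Interprets (relSym n a) w →
    ∀ t ∈ ZFSet.funs n A.dom, t ∈ v ↔ comp f t ∈ w
  func : ∀ n a v w, funSym n a ∈ L → A.Interprets (funSym n a) v → B.Interprets (funSym n a) w →
    ∀ t ∈ ZFSet.funs n A.dom, ∀ x y, ZFSet.pair t x ∈ v → ZFSet.pair x y ∈ f →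
      ZFSet.pair (comp f t) y ∈ w

/-- The set of elements of `B` that satisfy the 1-ary relation symbol `P`. -/
def Str.predSet (B : Str.{u}) (P : ZFSet.{u}) : ZFSet.{u} :=
  ZFSet.sep (fun b => ∃ v, B.Interprets P v ∧ {ZFSet.pair ∅ b} ∈ v) B.dom

/-- `A` is the `L'`-structure inside `B` whose domain is the set `P^B`; that is, `A = B⁻`. -/
structure IsMinus (L' P : ZFSet.{u}) (B A : Str.{u}) : Prop where
  isStr : IsStr L' A
  dom_eq : A.dom = B.predSet P
  rel : ∀ n a v w, relSym n a ∈ L' → A.Interprets (relSym n a) v → B.Interprets (relSym n a) w →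
    ∀ t ∈ ZFSet.funs n A.dom, t ∈ v ↔ t ∈ w
  func : ∀ n a v w, funSym n a ∈ L' → A.Interprets (funSym n a) v → B.Interprets (funSym n a) w →
    ∀ t ∈ ZFSet.funs n A.dom, ∀ x, ZFSet.pair t x ∈ v → ZFSet.pair t x ∈ w

/-! ### Constructions -/

/-- The three formulas of a construction, the two languages that the first two define, and the
designated 1-ary relation symbol `P`. -/
structure ConstructionData (M : Set ZFSet.{u}) where
  φ₁ : ParamFormula M 1
  φ₂ : ParamFormula M 1
  φ₃ : ParamFormula M 1
  L : ZFSet.{u}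
  L' : ZFSet.{u}
  P : ZFSet.{u}

namespace ConstructionData

variable {M : Set ZFSet.{u}}

/-- `B` is in the graph. -/
def InGraph (C : ConstructionData M) (B : Str.{u}) : Prop := Holds₁ C.φ₃ B.code

/-- `A = B⁻`. -/
def Minus (C : ConstructionData M) (B A : Str.{u}) : Prop := IsMinus C.L' C.P B A

/-- `A` is in the domain: `A = B⁻` for some `B` in the graph. -/
def InDomain (C : ConstructionData M) (A : Str.{u}) : Prop := ∃ B, C.InGraph B ∧ C.Minus B A

end ConstructionData

/-- Constructions in `M`. All isomorphisms are elements of `M`. -/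
structure Construction (M : Set ZFSet.{u}) extends ConstructionData M where
  L_mem : L ∈ M
  L'_mem : L' ∈ M
  L_isLanguage : IsLanguage L
  L'_isLanguage : IsLanguage L'
  φ₁_defines : ∀ s, Holds₁ φ₁ s ↔ s ∈ L
  φ₂_defines : ∀ s, Holds₁ φ₂ s ↔ s ∈ L'
  L'_subset : L' ⊆ L
  P_mem : P ∈ L
  P_notMem : P ∉ L'
  P_unary : ∃ a, P = relSym {∅} a
  graph_isStr : ∀ x, Holds₁ φ₃ x → ∃ B : Str.{u}, x = B.code ∧ IsStr L B
  exists_minus : ∀ B, toConstructionData.InGraph B →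
    ∃ A : Str.{u}, A.code ∈ M ∧ toConstructionData.Minus B A
  domain_closed : ∀ A A' : Str.{u}, toConstructionData.InDomain A → A'.code ∈ M → IsStr L' A' →
    (∃ f ∈ M, IsIso L' A A' f) → toConstructionData.InDomain A'
  extends_iso : ∀ A B A₀ B₀ : Str.{u}, toConstructionData.InGraph A →
    toConstructionData.InGraph B → toConstructionData.Minus A A₀ →
    toConstructionData.Minus B B₀ → ∀ f ∈ M, IsIso L' A₀ B₀ f →
    ∃ g ∈ M, IsIso L A B g ∧ f ⊆ g

/-! ### Automorphism groups in `M`, splittings and weak splittings -/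

/-- The automorphism group, in `M`, of an `L`-structure; the group operation is `comp`. -/
def autSet (M : Set ZFSet.{u}) (L : ZFSet.{u}) (A : Str.{u}) : ZFSet.{u} :=
  ZFSet.sep (fun f => f ∈ M ∧ IsIso L A A f) (ZFSet.powerset (ZFSet.prod A.dom A.dom))

/-- The product `f₁^ε₁ ⋯ f_k^ε_k` of permutations of `D`, where `true` stands for the exponent `1`
and `false` for `-1`. -/
def wordProd (D : ZFSet.{u}) : List (ZFSet.{u} × Bool) → ZFSet.{u}
  | [] => idOn D
  | (f, true) :: w => comp f (wordProd D w)
  | (f, false) :: w => comp (inv f) (wordProd D w)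

/-- The restriction of `s` to `H` is a map from `H` to `G`, and this map is an element of `M`. -/
def IsMapIn (M : Set ZFSet.{u}) (H G : ZFSet.{u}) (s : ZFSet.{u} → ZFSet.{u}) : Prop :=
  (∀ h ∈ H, s h ∈ G) ∧ ∃ c ∈ M, ∀ p, p ∈ c ↔ ∃ h ∈ H, p = ZFSet.pair h (s h)

/-- `G₀` is a commutative subgroup of the group `G` of permutations of `D`. -/
structure IsCommSubgroup (D G G₀ : ZFSet.{u}) : Prop where
  subset : G₀ ⊆ G
  one_mem : idOn D ∈ G₀
  mul_mem : ∀ f ∈ G₀, ∀ g ∈ G₀, comp f g ∈ G₀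
  inv_mem : ∀ f ∈ G₀, inv f ∈ G₀
  comm : ∀ f ∈ G₀, ∀ g ∈ G₀, comp f g = comp g f

namespace Construction

variable {M : Set ZFSet.{u}}

/-- Here `A = B⁻`. In `M`, the restriction map `Aut(B) → Aut(A)` splits. -/
def Splits (C : Construction M) (B A : Str.{u}) : Prop :=
  ∃ s : ZFSet.{u} → ZFSet.{u},
    IsMapIn M (autSet M C.L' A) (autSet M C.L B) s ∧
    (∀ h ∈ autSet M C.L' A, restrict (s h) A.dom = h) ∧
    ∀ h ∈ autSet M C.L' A, ∀ h' ∈ autSet M C.L' A, s (comp h h') = comp (s h) (s h')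

/-- Here `A = B⁻`. In `M`, the restriction map `Aut(B) → Aut(A)` weakly splits. -/
def WeaklySplits (C : Construction M) (B A : Str.{u}) : Prop :=
  ∃ s : ZFSet.{u} → ZFSet.{u},
    IsMapIn M (autSet M C.L' A) (autSet M C.L B) s ∧
    (∀ h ∈ autSet M C.L' A, restrict (s h) A.dom = h) ∧
    ∃ G₀ ∈ M, IsCommSubgroup B.dom (autSet M C.L B) G₀ ∧
      ∀ w : List (ZFSet.{u} × Bool), (∀ p ∈ w, p.1 ∈ autSet M C.L' A) →
        wordProd A.dom w = idOn A.dom →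
        wordProd B.dom (w.map fun p => (s p.1, p.2)) ∈ G₀

def Natural (C : Construction M) : Prop :=
  ∀ B A, C.InGraph B → C.Minus B A → C.Splits B A

def WeaklyNatural (C : Construction M) : Prop :=
  ∀ B A, C.InGraph B → C.Minus B A → C.WeaklySplits B A

/-- No `B⁻`, for `B` in the graph, has a nontrivial automorphism in `M`. -/
def RigidBased (C : Construction M) : Prop :=
  ∀ B A, C.InGraph B → C.Minus B A → ∀ f ∈ M, IsIso C.L' A A f → f = idOn A.dom

/-- The domain contains exactly one isomorphism type. -/
def Unitype (C : Construction M) : Prop :=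
  (∃ A, C.InDomain A) ∧
    ∀ A A', C.InDomain A → C.InDomain A' → ∃ f ∈ M, IsIso C.L' A A' f

/-- Some formula, with parameters from `M`, uniformises the graph. -/
def Uniformisable (C : Construction M) : Prop :=
  ∃ φ₄ : ParamFormula M 2, ∀ A, C.InDomain A →
    ∃ B : Str.{u}, Holds₂ φ₄ A.code B.code ∧ (∀ y, Holds₂ φ₄ A.code y → y = B.code) ∧
      C.InGraph B ∧ C.Minus B A

end Construction

end NatDef

/-! Everything rests on one finite surjection `ν : G → H` that has no weak splitting, and on two
constructions that both add the same kind of hidden structure to a base.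

A base carries an `n`-ary relation `r` that is a torsor of `n`-tuples under `H`. A structure in the
graph has `m` further points and a torsor `R` of `(n + m)`-tuples under `G`, lying over `r` through
`ν`. Since `ν` is onto, every isomorphism of bases lifts (`exists_lift`), so any definable
isomorphism-closed class of such bases yields a construction. In `fullClass` the domain of the base
is exhausted by the entries of one tuple of `r`. There is then one isomorphism type, and on numerals
the restriction map is a copy of `ν`. In `wellFoundedClass` the base also carries a binary relation
isomorphic to membership on a transitive set, and this makes it rigid.

The link is `uniformisable_fullClass`. A bare set `D` with a torsor has many automorphisms, but as a
set in `M` it has a definable transitive closure `T`, and `(T, r, ∈)` is a rigid base. A formula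
uniformising the rigid-based construction picks an extension over `T`; discarding the points of `T`
outside `D` leaves an extension over `D`. So the unitype construction is uniformisable as soon as
the rigid-based one is.

Under (a) and (b), `fullClass` would thus be weakly natural. This fails
(`not_weaklyNatural_fullClass`) when `H` has commuting pairs `a, b` and `a, c` such that, for all
lifts, `[a', b']` and `[a', c']` do not commute: both are values of words trivial in `H`, so a weak
splitting would put them in one commutative subgroup. Such an extension is the wreath product of the
Heisenberg group over `ZMod 2` with the group of order two, mapped onto `(ZMod 2)³`. If `a'` swaps
the coordinates, one coordinate of `[a', b']` is determined modulo the centre by `b` alone, so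
suitable `b` and `c` force two noncommuting Heisenberg elements.

For the last claim, rigidity makes `wellFoundedClass` trivially natural. If natural and
uniformisable coincided, it would be uniformisable, hence so would `fullClass`, which would then be
natural; but it is not. -/

namespace NatDef

/-! ### Definability with parameters over `(M, ∈)` -/

section Definability

variable {M : Set ZFSet.{u}} {α β : Type}

/-- `p` is defined over `(M, ∈)` by a formula with parameters from `M`. -/
def Def (p : (α → M) → Prop) : Prop :=
  ∃ φ : (setLang[[M]]).Formula α, ∀ v, φ.Realize v ↔ p v

/-- `f` takes values in `M` and its graph is definable over `(M, ∈)`. -/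
def DefF (f : (α → M) → ZFSet.{u}) : Prop :=
  (∀ v, f v ∈ M) ∧ Def fun w : Option α → M => (w none : ZFSet.{u}) = f fun i => w (some i)

theorem Def.congr {p q : (α → M) → Prop} (hp : Def p) (h : ∀ v, q v ↔ p v) : Def q := by
  obtain ⟨φ, hφ⟩ := hp
  exact ⟨φ, fun v => (hφ v).trans (h v).symm⟩

theorem Def.reindex {p : (α → M) → Prop} (hp : Def p) (σ : α → β) :
    Def fun w : β → M => p fun i => w (σ i) := by
  obtain ⟨φ, hφ⟩ := hp
  exact ⟨φ.relabel σ, fun v => by rw [Language.Formula.realize_relabel]; exact hφ _⟩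

theorem Def.and {p q : (α → M) → Prop} (hp : Def p) (hq : Def q) : Def fun v => p v ∧ q v := by
  obtain ⟨φ, hφ⟩ := hp
  obtain ⟨ψ, hψ⟩ := hq
  exact ⟨φ ⊓ ψ, fun v => by rw [Language.Formula.realize_inf, hφ, hψ]⟩

theorem Def.not {p : (α → M) → Prop} (hp : Def p) : Def fun v => ¬ p v := by
  obtain ⟨φ, hφ⟩ := hp
  exact ⟨φ.not, fun v => by rw [Language.Formula.realize_not, hφ]⟩

theorem Def.imp {p q : (α → M) → Prop} (hp : Def p) (hq : Def q) : Def fun v => p v → q v :=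
  (hp.and hq.not).not.congr fun v => by tauto

theorem Def.or {p q : (α → M) → Prop} (hp : Def p) (hq : Def q) : Def fun v => p v ∨ q v :=
  (hp.not.imp hq).congr fun v => by tauto

theorem Def.iff {p q : (α → M) → Prop} (hp : Def p) (hq : Def q) : Def fun v => (p v ↔ q v) :=
  ((hp.imp hq).and (hq.imp hp)).congr fun v => by tauto

/-- A whole finite tuple is quantified at once because the enumerations used later have length `n`
or `n + m`, which are not fixed numerals. -/
theorem Def.exists_block [Finite β] {p : (α → M) → (β → ZFSet.{u}) → Prop}
    (hp : Def fun w : α ⊕ β → M => p (fun i => w (Sum.inl i)) fun j => (w (Sum.inr j) : ZFSet.{u})) :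
    Def fun v => ∃ x : β → ZFSet.{u}, (∀ j, x j ∈ M) ∧ p v x := by
  obtain ⟨φ, hφ⟩ := hp
  refine ⟨φ.iExs β, fun v => ?_⟩
  rw [Language.Formula.realize_iExs]
  constructor
  · rintro ⟨x, hx⟩
    exact ⟨fun j => x j, fun j => (x j).2, (hφ _).1 hx⟩
  · rintro ⟨x, hx, h⟩
    exact ⟨fun j => ⟨x j, hx j⟩, (hφ _).2 h⟩

/-- The bound variable is `none` in `Option α`, so nested quantifiers are handled by iterating
`Option` and earlier variables are reached through `some`. -/
theorem Def.ex {p : (α → M) → ZFSet.{u} → Prop}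
    (hp : Def fun w : Option α → M => p (fun i => w (some i)) (w none)) :
    Def fun v => ∃ x ∈ M, p v x := by
  refine (Def.exists_block (β := Unit) (p := fun v x => p v (x ())) <|
    hp.reindex (fun o : Option α => o.elim (Sum.inr ()) Sum.inl)).congr fun v => ?_
  constructor
  · rintro ⟨x, hx, h⟩
    exact ⟨fun _ => x, fun _ => hx, h⟩
  · rintro ⟨x, hx, h⟩
    exact ⟨_, hx (), h⟩

theorem Def.all {p : (α → M) → ZFSet.{u} → Prop}
    (hp : Def fun w : Option α → M => p (fun i => w (some i)) (w none)) :
    Def fun v => ∀ x ∈ M, p v x :=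
  (Def.ex (p := fun v x => ¬ p v x) hp.not).not.congr fun v => by push Not; rfl

theorem Def.const (q : Prop) : Def fun _ : α → M => q := by
  by_cases h : q
  · exact ⟨⊤, fun v => by simp [h]⟩
  · exact ⟨⊥, fun v => by simp [h]⟩

theorem Def.exists_index {ι : Type*} [Finite ι] {p : ι → (α → M) → Prop} (hp : ∀ i, Def (p i)) :
    Def fun v => ∃ i, p i v := by
  choose φ hφ using hp
  refine ⟨Language.BoundedFormula.iSup φ, fun v => ?_⟩
  rw [Language.Formula.Realize, Language.BoundedFormula.realize_iSup]
  exact exists_congr fun i => hφ i v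

theorem Def.forall_index {ι : Type*} [Finite ι] {p : ι → (α → M) → Prop} (hp : ∀ i, Def (p i)) :
    Def fun v => ∀ i, p i v :=
  (Def.exists_index fun i => (hp i).not).not.congr fun v => by push Not; rfl

theorem DefF.var (i : α) : DefF fun v : α → M => (v i : ZFSet.{u}) := by
  refine ⟨fun v => (v i).2,
    (Language.Term.var none).equal (Language.Term.var (some i)), fun v => ?_⟩
  rw [Language.Formula.realize_equal]
  exact Subtype.ext_iff

theorem DefF.const {c : ZFSet.{u}} (hc : c ∈ M) : DefF fun _ : α → M => c := by
  refine ⟨fun v => hc,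
    (Language.Term.var none).equal (setLang.con (⟨c, hc⟩ : M)).term, fun v => ?_⟩
  rw [Language.Formula.realize_equal, Language.Term.realize_constants]
  exact Subtype.ext_iff

theorem DefF.reindex {f : (α → M) → ZFSet.{u}} (hf : DefF f) (σ : α → β) :
    DefF fun w : β → M => f fun i => w (σ i) :=
  ⟨fun _ => hf.1 _, hf.2.reindex (Option.map σ)⟩

theorem Def.mem_var (i j : α) : Def fun v : α → M => (v i : ZFSet.{u}) ∈ (v j : ZFSet.{u}) := by
  let R : (setLang[[M]]).Relations 2 := Sum.inl MemRel.mem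
  exact ⟨R.formula₂ (Language.Term.var i) (Language.Term.var j), fun v =>
    Language.Formula.realize_rel₂.trans Iff.rfl⟩

/-- Substitution of a definable function for one variable. -/
theorem Def.subst {p : (α → M) → ZFSet.{u} → Prop} {f : (α → M) → ZFSet.{u}}
    (hp : Def fun w : Option α → M => p (fun i => w (some i)) (w none)) (hf : DefF f) :
    Def fun v => p v (f v) := by
  refine (Def.ex (p := fun v x => x = f v ∧ p v x) (hf.2.and hp)).congr fun v => ?_
  constructor
  · intro h
    exact ⟨_, hf.1 v, rfl, h⟩
  · rintro ⟨x, _, rfl, h⟩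
    exact h

theorem Def.mem {f g : (α → M) → ZFSet.{u}} (hf : DefF f) (hg : DefF g) :
    Def fun v => f v ∈ g v := by
  refine Def.subst (p := fun v x => x ∈ g v) ?_ hf
  exact Def.subst (p := fun w x => (w none : ZFSet.{u}) ∈ x) (Def.mem_var _ _) (hg.reindex some)

theorem Def.eq {f g : (α → M) → ZFSet.{u}} (hf : DefF f) (hg : DefF g) :
    Def fun v => f v = g v :=
  Def.subst (p := fun v x => x = g v) hg.2 hf

/-- Transitivity makes bounded quantifiers absolute: elements of a member of `M` are themselves in
`M`. -/
theorem Def.exMem {p : (α → M) → ZFSet.{u} → Prop} {f : (α → M) → ZFSet.{u}} (hf : DefF f)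
    (hM : ∀ x ∈ M, ∀ y ∈ x, y ∈ M)
    (hp : Def fun w : Option α → M => p (fun i => w (some i)) (w none)) :
    Def fun v => ∃ x ∈ f v, p v x := by
  refine (Def.ex (p := fun v x => x ∈ f v ∧ p v x)
    ((Def.mem (.var none) (hf.reindex some)).and hp)).congr fun v => ?_
  constructor
  · rintro ⟨x, hx, h⟩
    exact ⟨x, hM _ (hf.1 v) _ hx, hx, h⟩
  · rintro ⟨x, _, hx, h⟩
    exact ⟨x, hx, h⟩

theorem Def.allMem {p : (α → M) → ZFSet.{u} → Prop} {f : (α → M) → ZFSet.{u}} (hf : DefF f)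
    (hM : ∀ x ∈ M, ∀ y ∈ x, y ∈ M)
    (hp : Def fun w : Option α → M => p (fun i => w (some i)) (w none)) :
    Def fun v => ∀ x ∈ f v, p v x :=
  (Def.exMem (p := fun v x => ¬ p v x) hf hM hp.not).not.congr fun v => by push Not; rfl

theorem Def.exists_holds₁ {p : ZFSet.{u} → Prop} (hp : Def fun v : Fin 1 → M => p (v 0)) :
    ∃ φ : ParamFormula M 1, ∀ x, Holds₁ φ x ↔ x ∈ M ∧ p x := by
  obtain ⟨φ, hφ⟩ := hp
  exact ⟨φ, fun x => ⟨fun ⟨hx, h⟩ => ⟨hx, (hφ _).1 h⟩, fun ⟨hx, h⟩ => ⟨hx, (hφ _).2 h⟩⟩⟩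

theorem Def.exists_holds₂ {p : ZFSet.{u} → ZFSet.{u} → Prop}
    (hp : Def fun v : Fin 2 → M => p (v 0) (v 1)) :
    ∃ φ : ParamFormula M 2, ∀ x y, Holds₂ φ x y ↔ x ∈ M ∧ y ∈ M ∧ p x y := by
  obtain ⟨φ, hφ⟩ := hp
  exact ⟨φ, fun x y => ⟨fun ⟨hx, hy, h⟩ => ⟨hx, hy, (hφ _).1 h⟩,
    fun ⟨hx, hy, h⟩ => ⟨hx, hy, (hφ _).2 h⟩⟩⟩

theorem def_holds₂ (φ : ParamFormula M 2) {f g : (α → M) → ZFSet.{u}} (hf : DefF f)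
    (hg : DefF g) : Def fun v => Holds₂ φ (f v) (g v) := by
  refine Def.subst (p := fun v x => Holds₂ φ x (g v)) ?_ hf
  refine Def.subst (p := fun w x => Holds₂ φ (w none) x) ?_ (hg.reindex some)
  refine Def.congr (p := fun w => φ.Realize ![w (some none), w none])
    ⟨φ.relabel ![some none, none], fun v => ?_⟩ fun w => ?_
  · rw [Language.Formula.realize_relabel]
    refine iff_of_eq (congrArg _ (funext fun i => ?_))
    fin_cases i <;> rfl
  · exact ⟨fun ⟨_, _, h⟩ => h, fun h => ⟨(w (some none)).2, (w none).2, h⟩⟩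

end Definability

/-! ### Closure properties of a transitive model -/

namespace IsTransitiveModelZFC

variable {M : Set ZFSet.{u}} {α : Type}

theorem mem_of_mem (hM : IsTransitiveModelZFC M) {x y : ZFSet.{u}} (hx : x ∈ M) (hy : y ∈ x) :
    y ∈ M :=
  hM.transitive x hx y hy

/-- Separation in `M` yields a set with the right elements from `M`; by transitivity neither it nor
the true separation has any others, so the two coincide. The closure lemmas for pairs, unions and
images follow the same pattern. -/
theorem sep_mem (hM : IsTransitiveModelZFC M) {p : ZFSet.{u} → Prop}
    (hp : Def fun v : Fin 1 → M => p (v 0)) {x : ZFSet.{u}} (hx : x ∈ M) :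
    ZFSet.sep p x ∈ M := by
  obtain ⟨φ, hφ⟩ := hp.exists_holds₁
  obtain ⟨y, hy, h⟩ := hM.separation φ x hx
  convert hy
  ext z
  rw [ZFSet.mem_sep]
  constructor
  · rintro ⟨hz, hp⟩
    have hz' := hM.mem_of_mem hx hz
    exact (h z hz').2 ⟨hz, (hφ z).2 ⟨hz', hp⟩⟩
  · intro hz
    have h' := (h z (hM.mem_of_mem hy hz)).1 hz
    exact ⟨h'.1, ((hφ z).1 h'.2).2⟩

theorem empty_mem (hM : IsTransitiveModelZFC M) : (∅ : ZFSet.{u}) ∈ M := by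
  obtain ⟨x, hx, ⟨e, he, -, h⟩, -⟩ := hM.infinity
  convert he
  exact (ZFSet.eq_empty _).2 (fun z hz => h z (hM.mem_of_mem he hz) hz) |>.symm

theorem upair_mem (hM : IsTransitiveModelZFC M) {x y : ZFSet.{u}} (hx : x ∈ M) (hy : y ∈ M) :
    ({x, y} : ZFSet.{u}) ∈ M := by
  obtain ⟨z, hz, h⟩ := hM.pairing x hx y hy
  convert hz
  ext w
  rw [ZFSet.mem_pair]
  constructor
  · intro hw
    exact (h w (by rcases hw with rfl | rfl <;> assumption)).2 hw
  · exact fun hw => (h w (hM.mem_of_mem hz hw)).1 hw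

theorem singleton_mem (hM : IsTransitiveModelZFC M) {x : ZFSet.{u}} (hx : x ∈ M) :
    ({x} : ZFSet.{u}) ∈ M := by
  convert hM.upair_mem hx hx
  ext z
  simp

theorem pair_mem (hM : IsTransitiveModelZFC M) {x y : ZFSet.{u}} (hx : x ∈ M) (hy : y ∈ M) :
    ZFSet.pair x y ∈ M :=
  hM.upair_mem (hM.singleton_mem hx) (hM.upair_mem hx hy)

theorem of_pair_mem (hM : IsTransitiveModelZFC M) {x y : ZFSet.{u}} (h : ZFSet.pair x y ∈ M) :
    x ∈ M ∧ y ∈ M := by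
  have h' : ({x, y} : ZFSet.{u}) ∈ M := hM.mem_of_mem h (by simp [ZFSet.pair])
  exact ⟨hM.mem_of_mem h' (by simp), hM.mem_of_mem h' (by simp)⟩

theorem sUnion_mem (hM : IsTransitiveModelZFC M) {x : ZFSet.{u}} (hx : x ∈ M) :
    ZFSet.sUnion x ∈ M := by
  obtain ⟨y, hy, h⟩ := hM.union x hx
  convert hy
  ext z
  rw [ZFSet.mem_sUnion]
  constructor
  · rintro ⟨w, hw, hz⟩
    have hw' := hM.mem_of_mem hx hw
    exact (h z (hM.mem_of_mem hw' hz)).2 ⟨w, hw', hw, hz⟩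
  · intro hz
    obtain ⟨w, _, hw, hz⟩ := (h z (hM.mem_of_mem hy hz)).1 hz
    exact ⟨w, hw, hz⟩

theorem union_mem (hM : IsTransitiveModelZFC M) {x y : ZFSet.{u}} (hx : x ∈ M) (hy : y ∈ M) :
    x ∪ y ∈ M :=
  hM.sUnion_mem (hM.upair_mem hx hy)

theorem insert_mem (hM : IsTransitiveModelZFC M) {x y : ZFSet.{u}} (hx : x ∈ M) (hy : y ∈ M) :
    insert x y ∈ M := by
  convert hM.union_mem (hM.singleton_mem hx) hy
  ext z
  simp

/-- Externally finite sets of elements of `M` belong to `M`, by iterated insertion. Hence languages,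
tuples and orbits of finite groups can be built outside `M` without leaving it. -/
theorem mem_of_finite (hM : IsTransitiveModelZFC M) {x : ZFSet.{u}}
    (hx : {y | y ∈ x}.Finite) (h : ∀ y ∈ x, y ∈ M) : x ∈ M := by
  suffices H : ∀ s : Set ZFSet.{u}, s.Finite → (∀ y ∈ s, y ∈ M) → ∃ z ∈ M, ∀ y, y ∈ z ↔ y ∈ s by
    obtain ⟨z, hz, h'⟩ := H _ hx h
    convert hz
    ext y
    exact (h' y).symm
  intro s hs
  induction s, hs using Set.Finite.induction_on with
  | empty => exact fun _ => ⟨∅, hM.empty_mem, fun y => by simp⟩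
  | @insert a s _ _ ih =>
    intro h
    obtain ⟨z, hz, h'⟩ := ih fun y hy => h y (Set.mem_insert_of_mem _ hy)
    exact ⟨insert a z, hM.insert_mem (h a (Set.mem_insert _ _)) hz, fun y => by simp [h']⟩

theorem range_mem (hM : IsTransitiveModelZFC M) {ι : Type} [Finite ι] {f : ι → ZFSet.{u}}
    (hf : ∀ i, f i ∈ M) : ZFSet.range f ∈ M := by
  refine hM.mem_of_finite ?_ ?_
  · convert Set.finite_range f
    ext y
    simp
  · intro y hy
    obtain ⟨i, rfl⟩ := ZFSet.mem_range.1 hy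
    exact hf i

theorem exists_image (hM : IsTransitiveModelZFC M) {F : ZFSet.{u} → ZFSet.{u}}
    (hF : DefF fun v : Fin 1 → M => F (v 0)) {x : ZFSet.{u}} (hx : x ∈ M) :
    ∃ y ∈ M, ∀ b, b ∈ y ↔ ∃ a ∈ x, b = F a := by
  obtain ⟨φ, hφ⟩ := Def.exists_holds₂ (M := M) (p := fun a b => b = F a) <| by
    exact Def.eq (.var 1) (hF.reindex fun _ => 0)
  have hFM : ∀ a ∈ M, F a ∈ M := fun a ha => hF.1 fun _ => ⟨a, ha⟩
  obtain ⟨y, hy, h⟩ := hM.replacement φ x hx fun a ha _ =>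
    ⟨F a, ⟨hFM a ha, (hφ _ _).2 ⟨ha, hFM a ha, rfl⟩⟩, fun b hb => ((hφ _ _).1 hb.2).2.2⟩
  refine ⟨y, hy, fun b => ⟨fun hb => ?_, ?_⟩⟩
  · obtain ⟨a, _, ha, h'⟩ := (h b (hM.mem_of_mem hy hb)).1 hb
    exact ⟨a, ha, ((hφ _ _).1 h').2.2⟩
  · rintro ⟨a, ha, rfl⟩
    have ha' := hM.mem_of_mem hx ha
    exact (h _ (hFM a ha')).2 ⟨a, ha', ha, (hφ _ _).2 ⟨ha', hFM a ha', rfl⟩⟩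

/-- A function into `M` is definable if membership in its values is. -/
theorem defF_of_mem (hM : IsTransitiveModelZFC M) {f : (α → M) → ZFSet.{u}} (hf : ∀ v, f v ∈ M)
    (h : Def fun w : Option α → M => (w none : ZFSet.{u}) ∈ f fun i => w (some i)) : DefF f := by
  refine ⟨hf, (Def.all (p := fun w z => z ∈ (w none : ZFSet.{u}) ↔ z ∈ f fun i => w (some i))
    ((Def.mem (.var _) (.var _)).iff ?_)).congr fun w => ?_⟩
  · exact h.reindex (Option.map some)
  · constructor
    · intro h z _
      rw [h]
    · intro h
      ext z
      exact ⟨fun hz => (h z (hM.mem_of_mem (w none).2 hz)).1 hz,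
        fun hz => (h z (hM.mem_of_mem (hf _) hz)).2 hz⟩

theorem defF_upair (hM : IsTransitiveModelZFC M) {f g : (α → M) → ZFSet.{u}} (hf : DefF f)
    (hg : DefF g) : DefF fun v => ({f v, g v} : ZFSet.{u}) :=
  hM.defF_of_mem (fun v => hM.upair_mem (hf.1 v) (hg.1 v)) <|
    ((Def.eq (.var none) (hf.reindex some)).or (Def.eq (.var none) (hg.reindex some))).congr fun w => by simp

theorem defF_singleton (hM : IsTransitiveModelZFC M) {f : (α → M) → ZFSet.{u}} (hf : DefF f) :
    DefF fun v => ({f v} : ZFSet.{u}) :=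
  hM.defF_of_mem (fun v => hM.singleton_mem (hf.1 v)) <|
    (Def.eq (.var none) (hf.reindex some)).congr fun w => by simp

theorem defF_pair (hM : IsTransitiveModelZFC M) {f g : (α → M) → ZFSet.{u}} (hf : DefF f)
    (hg : DefF g) : DefF fun v => ZFSet.pair (f v) (g v) :=
  hM.defF_upair (hM.defF_singleton hf) (hM.defF_upair hf hg)

theorem defF_range (hM : IsTransitiveModelZFC M) {ι : Type} [Finite ι]
    {f : ι → (α → M) → ZFSet.{u}} (hf : ∀ i, DefF (f i)) :
    DefF fun v => ZFSet.range fun i => f i v :=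
  hM.defF_of_mem (fun v => hM.range_mem fun i => (hf i).1 v) <|
    (Def.exists_index fun i => Def.eq (.var none) ((hf i).reindex some)).congr fun w => by
      simp [eq_comm]

end IsTransitiveModelZFC

/-! ### Transitive closures -/

/-- `T` is the least transitive superset of `x` in `M`. -/
def IsTC (M : Set ZFSet.{u}) (x T : ZFSet.{u}) : Prop :=
  T.IsTransitive ∧ x ⊆ T ∧ ∀ S ∈ M, S.IsTransitive → x ⊆ S → T ⊆ S

theorem IsTC.unique {M : Set ZFSet.{u}} {x T T' : ZFSet.{u}} (h : IsTC M x T) (h' : IsTC M x T')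
    (hT : T ∈ M) (hT' : T' ∈ M) : T = T' :=
  subset_antisymm (h.2.2 T' hT' h'.1 h'.2.1) (h'.2.2 T hT h.1 h.2.1)

namespace IsTransitiveModelZFC

variable {M : Set ZFSet.{u}} {α : Type}

theorem def_subset (hM : IsTransitiveModelZFC M) {f g : (α → M) → ZFSet.{u}} (hf : DefF f)
    (hg : DefF g) : Def fun v => f v ⊆ g v :=
  (Def.allMem (p := fun v x => x ∈ g v) hf hM.transitive (Def.mem (.var _) (hg.reindex _))).congr
    fun _ => Iff.rfl

theorem def_isTransitive (hM : IsTransitiveModelZFC M) {f : (α → M) → ZFSet.{u}} (hf : DefF f) :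
    Def fun v => (f v).IsTransitive :=
  (Def.allMem (p := fun v x => x ⊆ f v) hf hM.transitive
    (hM.def_subset (.var _) (hf.reindex _))).congr fun _ => Iff.rfl

theorem def_isTC (hM : IsTransitiveModelZFC M) {f g : (α → M) → ZFSet.{u}} (hf : DefF f)
    (hg : DefF g) : Def fun v => IsTC M (f v) (g v) :=
  (hM.def_isTransitive hg).and <| (hM.def_subset hf hg).and <|
    Def.all (p := fun v S => S.IsTransitive → f v ⊆ S → g v ⊆ S) <|
      (hM.def_isTransitive (.var _)).imp <| (hM.def_subset (hf.reindex _) (.var _)).imp <|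
        hM.def_subset (hg.reindex _) (.var _)

/-- By ∈-induction: adjoin to `x` the closures of its elements, collected by replacement. Uniqueness
of closures in `M` makes the relation functional, so no recursion along `ω` inside `M` is required.
-/
theorem exists_isTC (hM : IsTransitiveModelZFC M) {x : ZFSet.{u}} (hx : x ∈ M) :
    ∃ T ∈ M, IsTC M x T := by
  induction x using ZFSet.inductionOn with
  | h x ih =>
  obtain ⟨φ, hφ⟩ := Def.exists_holds₂ (M := M) (p := IsTC M) (hM.def_isTC (.var 0) (.var 1))
  obtain ⟨Y, hY, h⟩ := hM.replacement φ x hx fun a ha hax => by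
    obtain ⟨T, hT, hTC⟩ := ih a hax ha
    exact ⟨T, ⟨hT, (hφ _ _).2 ⟨ha, hT, hTC⟩⟩, fun S hS =>
      ((hφ _ _).1 hS.2).2.2.unique hTC hS.1 hT⟩
  have hYx : ∀ T ∈ Y, ∃ a ∈ x, IsTC M a T := fun T hT => by
    obtain ⟨a, _, hax, h'⟩ := (h T (hM.mem_of_mem hY hT)).1 hT
    exact ⟨a, hax, ((hφ _ _).1 h').2.2⟩
  refine ⟨x ∪ ZFSet.sUnion Y, hM.union_mem hx (hM.sUnion_mem hY), fun a ha z hz => ?_,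
    fun z hz => by simp [hz], fun S _ hS hxS z hz => ?_⟩
  · rw [ZFSet.mem_union, ZFSet.mem_sUnion] at ha ⊢
    right
    rcases ha with ha | ⟨T, hT, ha⟩
    · have haM := hM.mem_of_mem hx ha
      obtain ⟨T, hT, hTC⟩ := ih a ha haM
      exact ⟨T, (h T hT).2 ⟨a, haM, ha, (hφ _ _).2 ⟨haM, hT, hTC⟩⟩, hTC.2.1 hz⟩
    · obtain ⟨_, _, hTC⟩ := hYx T hT
      exact ⟨T, hT, hTC.1 a ha hz⟩
  · rw [ZFSet.mem_union, ZFSet.mem_sUnion] at hz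
    rcases hz with hz | ⟨T, hT, hz⟩
    · exact hxS hz
    · obtain ⟨a, ha, hTC⟩ := hYx T hT
      exact hTC.2.2 S ‹_› hS (hS a (hxS ha)) hz

end IsTransitiveModelZFC

/-! ### Sets of ordered pairs -/

theorem mem_comp {g f p : ZFSet.{u}} :
    p ∈ comp g f ↔ ∃ x y z, p = ZFSet.pair x z ∧ ZFSet.pair x y ∈ f ∧ ZFSet.pair y z ∈ g := by
  rw [comp, ZFSet.mem_sep, and_iff_right_iff_imp]
  rintro ⟨x, y, z, rfl, hf, hg⟩
  refine ZFSet.pair_mem_prod.2 ⟨ZFSet.mem_sUnion.2 ⟨{x, y}, ZFSet.mem_sUnion.2 ⟨_, hf, ?_⟩, ?_⟩,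
    ZFSet.mem_sUnion.2 ⟨{y, z}, ZFSet.mem_sUnion.2 ⟨_, hg, ?_⟩, ?_⟩⟩ <;> simp [ZFSet.pair]

theorem mem_inv {f p : ZFSet.{u}} :
    p ∈ inv f ↔ ∃ x y, p = ZFSet.pair y x ∧ ZFSet.pair x y ∈ f := by
  rw [inv, ZFSet.mem_sep, and_iff_right_iff_imp]
  rintro ⟨x, y, rfl, hf⟩
  refine ZFSet.pair_mem_prod.2 ⟨ZFSet.mem_sUnion.2 ⟨{x, y}, ZFSet.mem_sUnion.2 ⟨_, hf, ?_⟩, ?_⟩,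
    ZFSet.mem_sUnion.2 ⟨{x, y}, ZFSet.mem_sUnion.2 ⟨_, hf, ?_⟩, ?_⟩⟩ <;> simp [ZFSet.pair]

theorem mem_idOn {D p : ZFSet.{u}} : p ∈ idOn D ↔ ∃ x ∈ D, p = ZFSet.pair x x := by
  rw [idOn, ZFSet.mem_sep]
  constructor
  · rintro ⟨h, x, rfl⟩
    exact ⟨x, (ZFSet.pair_mem_prod.1 h).1, rfl⟩
  · rintro ⟨x, hx, rfl⟩
    exact ⟨ZFSet.pair_mem_prod.2 ⟨hx, hx⟩, x, rfl⟩

/-- The set `f` is the graph of the restriction of `F` to `D`. -/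
def IsGraphOn (F : ZFSet.{u} → ZFSet.{u}) (D f : ZFSet.{u}) : Prop :=
  ∀ p, p ∈ f ↔ ∃ x ∈ D, p = ZFSet.pair x (F x)

theorem IsGraphOn.pair_mem {F : ZFSet.{u} → ZFSet.{u}} {D f x y : ZFSet.{u}}
    (h : IsGraphOn F D f) : ZFSet.pair x y ∈ f ↔ x ∈ D ∧ y = F x := by
  rw [h]
  constructor
  · rintro ⟨x', hx', h⟩
    obtain ⟨rfl, rfl⟩ := ZFSet.pair_inj.1 h
    exact ⟨hx', rfl⟩
  · rintro ⟨hx, rfl⟩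
    exact ⟨x, hx, rfl⟩

theorem IsGraphOn.congr {F F' : ZFSet.{u} → ZFSet.{u}} {D f : ZFSet.{u}} (h : IsGraphOn F D f)
    (h' : ∀ x ∈ D, F' x = F x) : IsGraphOn F' D f := fun p => by
  rw [h]
  exact exists_congr fun x => and_congr_right fun hx => by rw [h' x hx]

theorem IsGraphOn.unique {F : ZFSet.{u} → ZFSet.{u}} {D f f' : ZFSet.{u}} (h : IsGraphOn F D f)
    (h' : IsGraphOn F D f') : f = f' := by
  ext p
  rw [h, h']

theorem isGraphOn_idOn (D : ZFSet.{u}) : IsGraphOn id D (idOn D) := fun _ => mem_idOn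

/-- Passes from set-coded functions to Lean functions, with the junk value `∅` outside `D`; later
arguments about isomorphisms use this form. -/
theorem exists_isGraphOn {D E f : ZFSet.{u}} (h : ZFSet.IsFunc D E f) :
    ∃ F, (∀ x ∈ D, F x ∈ E) ∧ IsGraphOn F D f := by
  classical
  have H : ∀ x, ∃ y, x ∈ D → ZFSet.pair x y ∈ f := fun x => by
    by_cases hx : x ∈ D
    · obtain ⟨y, hy, -⟩ := h.2 x hx
      exact ⟨y, fun _ => hy⟩
    · exact ⟨∅, fun h => absurd h hx⟩
  choose F hF using H
  refine ⟨F, fun x hx => (ZFSet.pair_mem_prod.1 (h.1 (hF x hx))).2, fun p => ⟨fun hp => ?_, ?_⟩⟩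
  · obtain ⟨x, hx, y, hy, rfl⟩ := ZFSet.mem_prod.1 (h.1 hp)
    exact ⟨x, hx, by rw [(h.2 x hx).unique hp (hF x hx)]⟩
  · rintro ⟨x, hx, rfl⟩
    exact hF x hx

theorem IsGraphOn.isFunc {F : ZFSet.{u} → ZFSet.{u}} {D E f : ZFSet.{u}} (h : IsGraphOn F D f)
    (hF : ∀ x ∈ D, F x ∈ E) : ZFSet.IsFunc D E f := by
  refine ⟨fun p hp => ?_, fun x hx => ⟨F x, h.pair_mem.2 ⟨hx, rfl⟩,
    fun y hy => (h.pair_mem.1 hy).2⟩⟩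
  obtain ⟨x, hx, rfl⟩ := (h p).1 hp
  exact ZFSet.pair_mem_prod.2 ⟨hx, hF x hx⟩

/-- `F` maps `D` bijectively onto `E`. -/
structure BijOn (F : ZFSet.{u} → ZFSet.{u}) (D E : ZFSet.{u}) : Prop where
  maps : ∀ x ∈ D, F x ∈ E
  inj : ∀ x ∈ D, ∀ y ∈ D, F x = F y → x = y
  surj : ∀ y ∈ E, ∃ x ∈ D, F x = y

theorem IsBij.exists_bijOn {D E f : ZFSet.{u}} (h : IsBij D E f) :
    ∃ F, BijOn F D E ∧ IsGraphOn F D f := by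
  obtain ⟨F, hF, hf⟩ := exists_isGraphOn h.1
  refine ⟨F, ⟨hF, fun x hx y hy hxy => ?_, fun y hy => ?_⟩, hf⟩
  · exact (h.2 (F x) (hF x hx)).unique (hf.pair_mem.2 ⟨hx, rfl⟩) (hf.pair_mem.2 ⟨hy, hxy⟩)
  · obtain ⟨x, hxy, -⟩ := h.2 y hy
    obtain ⟨hx, rfl⟩ := hf.pair_mem.1 hxy
    exact ⟨x, hx, rfl⟩

theorem BijOn.isBij {F : ZFSet.{u} → ZFSet.{u}} {D E f : ZFSet.{u}} (h : BijOn F D E)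
    (hf : IsGraphOn F D f) : IsBij D E f := by
  refine ⟨hf.isFunc h.maps, fun y hy => ?_⟩
  obtain ⟨x, hx, rfl⟩ := h.surj y hy
  refine ⟨x, hf.pair_mem.2 ⟨hx, rfl⟩, fun x' hx' => ?_⟩
  obtain ⟨hx', h'⟩ := hf.pair_mem.1 hx'
  exact h.inj _ hx' _ hx h'.symm

theorem BijOn.id (D : ZFSet.{u}) : BijOn id D D :=
  ⟨fun _ h => h, fun _ _ _ _ h => h, fun y hy => ⟨y, hy, rfl⟩⟩

theorem BijOn.comp {F F' : ZFSet.{u} → ZFSet.{u}} {D E E' : ZFSet.{u}} (h : BijOn F D E)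
    (h' : BijOn F' E E') : BijOn (F' ∘ F) D E' := by
  refine ⟨fun x hx => h'.maps _ (h.maps x hx),
    fun x hx y hy hxy => h.inj x hx y hy (h'.inj _ (h.maps x hx) _ (h.maps y hy) hxy),
    fun z hz => ?_⟩
  obtain ⟨y, hy, rfl⟩ := h'.surj z hz
  obtain ⟨x, hx, rfl⟩ := h.surj y hy
  exact ⟨x, hx, rfl⟩

theorem BijOn.exists_inverse {F : ZFSet.{u} → ZFSet.{u}} {D E : ZFSet.{u}} (h : BijOn F D E) :
    ∃ F', BijOn F' E D ∧ (∀ x ∈ D, F' (F x) = x) ∧ ∀ y ∈ E, F (F' y) = y := by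
  classical
  have H : ∀ y, ∃ x, y ∈ E → x ∈ D ∧ F x = y := fun y => by
    by_cases hy : y ∈ E
    · obtain ⟨x, hx⟩ := h.surj y hy
      exact ⟨x, fun _ => hx⟩
    · exact ⟨∅, fun h => absurd h hy⟩
  choose F' hF' using H
  have hl : ∀ x ∈ D, F' (F x) = x := fun x hx =>
    h.inj _ (hF' _ (h.maps x hx)).1 _ hx (hF' _ (h.maps x hx)).2
  refine ⟨F', ⟨fun y hy => (hF' y hy).1, fun y hy z hz hyz => ?_,
    fun x hx => ⟨F x, h.maps x hx, hl x hx⟩⟩, hl, fun y hy => (hF' y hy).2⟩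
  rw [← (hF' y hy).2, hyz, (hF' z hz).2]

theorem IsGraphOn.comp {F F' : ZFSet.{u} → ZFSet.{u}} {D E f f' : ZFSet.{u}}
    (h : IsGraphOn F D f) (h' : IsGraphOn F' E f') (hF : ∀ x ∈ D, F x ∈ E) :
    IsGraphOn (F' ∘ F) D (comp f' f) := by
  intro p
  rw [mem_comp]
  constructor
  · rintro ⟨x, y, z, rfl, hf, hg⟩
    obtain ⟨hx, rfl⟩ := h.pair_mem.1 hf
    obtain ⟨hy, rfl⟩ := h'.pair_mem.1 hg
    exact ⟨x, hx, rfl⟩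
  · rintro ⟨x, hx, rfl⟩
    exact ⟨x, F x, _, rfl, h.pair_mem.2 ⟨hx, rfl⟩, h'.pair_mem.2 ⟨hF x hx, rfl⟩⟩

theorem IsGraphOn.inv {F F' : ZFSet.{u} → ZFSet.{u}} {D E f : ZFSet.{u}} (h : IsGraphOn F D f)
    (hF : BijOn F D E) (hl : ∀ x ∈ D, F' (F x) = x) : IsGraphOn F' E (inv f) := by
  intro p
  rw [mem_inv]
  constructor
  · rintro ⟨x, y, rfl, hf⟩
    obtain ⟨hx, rfl⟩ := h.pair_mem.1 hf
    exact ⟨F x, hF.maps x hx, by rw [hl x hx]⟩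
  · rintro ⟨y, hy, rfl⟩
    obtain ⟨x, hx, rfl⟩ := hF.surj y hy
    exact ⟨x, F x, by rw [hl x hx], h.pair_mem.2 ⟨hx, rfl⟩⟩

/-! ### Numerals and tuples -/

/-- The von Neumann numerals. -/
def num : ℕ → ZFSet.{u}
  | 0 => ∅
  | n + 1 => insert (num n) (num n)

theorem mem_num {n : ℕ} {x : ZFSet.{u}} : x ∈ num n ↔ ∃ i : Fin n, x = num i := by
  induction n with
  | zero => simp [num]
  | succ n ih =>
    rw [num, ZFSet.mem_insert_iff, ih]
    constructor
    · rintro (rfl | ⟨i, rfl⟩)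
      · exact ⟨Fin.last n, rfl⟩
      · exact ⟨i.castSucc, rfl⟩
    · rintro ⟨i, rfl⟩
      induction i using Fin.lastCases with
      | last => exact Or.inl rfl
      | cast i => exact Or.inr ⟨i, rfl⟩

theorem num_mem_num {i n : ℕ} (h : i < n) : num i ∈ num n := mem_num.2 ⟨⟨i, h⟩, rfl⟩

theorem num_injective : Function.Injective num := by
  intro i j h
  rcases lt_trichotomy i j with hij | hij | hij
  · exact absurd (h ▸ num_mem_num hij) (ZFSet.mem_irrefl _)
  · exact hij
  · exact absurd (h ▸ num_mem_num hij) (ZFSet.mem_irrefl _)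

theorem num_mem_omega (n : ℕ) : num n ∈ ZFSet.omega := by
  induction n with
  | zero => exact ZFSet.omega_zero
  | succ n ih => exact ZFSet.omega_succ ih

theorem num_one : num 1 = {∅} := by
  ext z
  simp [num]

/-- The tuple with entries `t i`, as a function on a numeral. -/
noncomputable def tup {n : ℕ} (t : Fin n → ZFSet.{u}) : ZFSet.{u} :=
  ZFSet.range fun i : Fin n => ZFSet.pair (num i) (t i)

theorem pair_mem_tup {n : ℕ} {t : Fin n → ZFSet.{u}} {x y : ZFSet.{u}} :
    ZFSet.pair x y ∈ tup t ↔ ∃ i : Fin n, x = num i ∧ y = t i := by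
  simp only [tup, ZFSet.mem_range, ZFSet.pair_inj, eq_comm]

theorem num_pair_mem_tup {n : ℕ} {t : Fin n → ZFSet.{u}} {i : Fin n} {y : ZFSet.{u}} :
    ZFSet.pair (num i) y ∈ tup t ↔ y = t i := by
  rw [pair_mem_tup]
  constructor
  · rintro ⟨j, h, rfl⟩
    rw [Fin.ext (num_injective h)]
  · exact fun h => ⟨i, rfl, h⟩

theorem tup_injective {n : ℕ} : Function.Injective (tup (n := n)) := by
  intro t t' h
  funext i
  have := num_pair_mem_tup.2 (rfl : t i = t i)
  rw [h] at this
  exact num_pair_mem_tup.1 this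

theorem tup_mem_funs {n : ℕ} {t : Fin n → ZFSet.{u}} {D : ZFSet.{u}} :
    tup t ∈ ZFSet.funs (num n) D ↔ ∀ i, t i ∈ D := by
  rw [ZFSet.mem_funs]
  constructor
  · intro h i
    exact (ZFSet.pair_mem_prod.1 (h.1 (num_pair_mem_tup.2 (rfl : t i = t i)))).2
  · intro h
    refine ⟨fun p hp => ?_, fun x hx => ?_⟩
    · obtain ⟨i, rfl⟩ := ZFSet.mem_range.1 hp
      exact ZFSet.pair_mem_prod.2 ⟨num_mem_num i.2, h i⟩
    · obtain ⟨i, rfl⟩ := mem_num.1 hx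
      exact ⟨t i, num_pair_mem_tup.2 rfl, fun y hy => num_pair_mem_tup.1 hy⟩

theorem exists_tup {n : ℕ} {D x : ZFSet.{u}} (h : x ∈ ZFSet.funs (num n) D) :
    ∃ t : Fin n → ZFSet.{u}, (∀ i, t i ∈ D) ∧ x = tup t := by
  obtain ⟨F, hF, hx⟩ := exists_isGraphOn (ZFSet.mem_funs.1 h)
  refine ⟨fun i => F (num i), fun i => hF _ (num_mem_num i.2), ?_⟩
  ext p
  rw [hx, tup, ZFSet.mem_range]
  constructor
  · rintro ⟨x, hx, rfl⟩
    obtain ⟨i, rfl⟩ := mem_num.1 hx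
    exact ⟨i, rfl⟩
  · rintro ⟨i, rfl⟩
    exact ⟨_, num_mem_num i.2, rfl⟩

theorem comp_tup {n : ℕ} {t : Fin n → ZFSet.{u}} {F : ZFSet.{u} → ZFSet.{u}} {D f : ZFSet.{u}}
    (h : IsGraphOn F D f) (ht : ∀ i, t i ∈ D) : comp f (tup t) = tup fun i => F (t i) := by
  ext p
  rw [mem_comp]
  constructor
  · rintro ⟨x, y, z, rfl, hx, hy⟩
    obtain ⟨i, rfl, rfl⟩ := pair_mem_tup.1 hx
    obtain ⟨-, rfl⟩ := h.pair_mem.1 hy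
    exact num_pair_mem_tup.2 rfl
  · intro hp
    obtain ⟨i, rfl⟩ := ZFSet.mem_range.1 hp
    exact ⟨num i, t i, _, rfl, num_pair_mem_tup.2 rfl, h.pair_mem.2 ⟨ht i, rfl⟩⟩

/-- Matches the coding of 1-tuples in `Str.predSet` with `tup`, since `num 0` is `∅`. -/
theorem singleton_pair_eq_tup (b : ZFSet.{u}) :
    ({ZFSet.pair ∅ b} : ZFSet.{u}) = tup fun _ : Fin 1 => b := by
  ext p
  simp [tup, num, eq_comm]

namespace IsTransitiveModelZFC

variable {M : Set ZFSet.{u}} {α : Type}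

theorem num_mem (hM : IsTransitiveModelZFC M) (n : ℕ) : num n ∈ M := by
  induction n with
  | zero => exact hM.empty_mem
  | succ n ih => exact hM.insert_mem ih ih

theorem tup_mem (hM : IsTransitiveModelZFC M) {n : ℕ} {t : Fin n → ZFSet.{u}}
    (h : ∀ i, t i ∈ M) : tup t ∈ M :=
  hM.range_mem fun i => hM.pair_mem (hM.num_mem i) (h i)

theorem defF_tup (hM : IsTransitiveModelZFC M) {n : ℕ} {f : Fin n → (α → M) → ZFSet.{u}}
    (h : ∀ i, DefF (f i)) : DefF fun v => tup fun i => f i v :=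
  hM.defF_range fun i => hM.defF_pair (.const (hM.num_mem i)) (h i)

theorem prod_mem (hM : IsTransitiveModelZFC M) {x y : ZFSet.{u}} (hx : x ∈ M) (hy : y ∈ M) :
    ZFSet.prod x y ∈ M := by
  -- The product is the union of its slices `{a} × y`: replacement over `y` gives each slice, and
  -- replacement over `x` gives the family of slices.
  have h₁ : ∀ a ∈ M, ZFSet.prod {a} y ∈ M := fun a ha => by
    obtain ⟨z, hz, h⟩ := hM.exists_image (F := fun b => ZFSet.pair a b)
      (hM.defF_pair (.const ha) (.var 0)) hy
    convert hz
    ext p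
    simp [h, ZFSet.mem_prod]
  have h₂ : DefF fun v : Fin 1 → M => ZFSet.prod {(v 0 : ZFSet.{u})} y := by
    refine hM.defF_of_mem (fun v => h₁ _ (v 0).2) ?_
    refine (Def.exMem (p := fun w b => (w none : ZFSet.{u}) = ZFSet.pair (w (some 0)) b)
      (.const hy) hM.transitive ?_).congr fun w => ?_
    · exact Def.eq (.var _) (hM.defF_pair (.var _) (.var _))
    · simp [ZFSet.mem_prod]
  obtain ⟨z, hz, h⟩ := hM.exists_image (F := fun a => ZFSet.prod {a} y) h₂ hx
  convert hM.sUnion_mem hz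
  ext p
  simp [h, ZFSet.mem_prod]

theorem sUnion_sUnion_mem (hM : IsTransitiveModelZFC M) {f : ZFSet.{u}} (hf : f ∈ M) :
    ZFSet.sUnion (ZFSet.sUnion f) ∈ M :=
  hM.sUnion_mem (hM.sUnion_mem hf)

theorem comp_mem (hM : IsTransitiveModelZFC M) {g f : ZFSet.{u}} (hg : g ∈ M) (hf : f ∈ M) :
    comp g f ∈ M := by
  have h : Def fun v : Fin 1 → M => ∃ x ∈ M, ∃ y ∈ M, ∃ z ∈ M,
      (v 0 : ZFSet.{u}) = ZFSet.pair x z ∧ ZFSet.pair x y ∈ f ∧ ZFSet.pair y z ∈ g :=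
    Def.ex <| Def.ex <| Def.ex <|
      (Def.eq (.var _) (hM.defF_pair (.var _) (.var _))).and <|
      (Def.mem (hM.defF_pair (.var _) (.var _)) (.const hf)).and <|
      Def.mem (hM.defF_pair (.var _) (.var _)) (.const hg)
  refine hM.sep_mem (h.congr fun v => ?_)
    (hM.prod_mem (hM.sUnion_sUnion_mem hf) (hM.sUnion_sUnion_mem hg))
  constructor
  · rintro ⟨x, y, z, h, hf', hg'⟩
    have h₁ := hM.of_pair_mem (hM.mem_of_mem hf hf')
    have h₂ := hM.of_pair_mem (hM.mem_of_mem hg hg')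
    exact ⟨x, h₁.1, y, h₁.2, z, h₂.2, h, hf', hg'⟩
  · rintro ⟨x, _, y, _, z, _, h⟩
    exact ⟨x, y, z, h⟩

theorem inv_mem (hM : IsTransitiveModelZFC M) {f : ZFSet.{u}} (hf : f ∈ M) : inv f ∈ M := by
  have h : Def fun v : Fin 1 → M => ∃ x ∈ M, ∃ y ∈ M,
      (v 0 : ZFSet.{u}) = ZFSet.pair y x ∧ ZFSet.pair x y ∈ f :=
    Def.ex <| Def.ex <| (Def.eq (.var _) (hM.defF_pair (.var _) (.var _))).and <|
      Def.mem (hM.defF_pair (.var _) (.var _)) (.const hf)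
  refine hM.sep_mem (h.congr fun v => ?_)
    (hM.prod_mem (hM.sUnion_sUnion_mem hf) (hM.sUnion_sUnion_mem hf))
  constructor
  · rintro ⟨x, y, h, hf'⟩
    have h₁ := hM.of_pair_mem (hM.mem_of_mem hf hf')
    exact ⟨x, h₁.1, y, h₁.2, h, hf'⟩
  · rintro ⟨x, _, y, _, h⟩
    exact ⟨x, y, h⟩

theorem idOn_mem (hM : IsTransitiveModelZFC M) {D : ZFSet.{u}} (hD : D ∈ M) : idOn D ∈ M := by
  have h : Def fun v : Fin 1 → M => ∃ x ∈ D, (v 0 : ZFSet.{u}) = ZFSet.pair x x :=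
    Def.exMem (.const hD) hM.transitive <| Def.eq (.var _) (hM.defF_pair (.var _) (.var _))
  convert hM.sep_mem (p := fun p => ∃ x ∈ D, p = ZFSet.pair x x) h (hM.prod_mem hD hD)
  ext p
  rw [mem_idOn, ZFSet.mem_sep, iff_and_self]
  rintro ⟨x, hx, rfl⟩
  exact ZFSet.pair_mem_prod.2 ⟨hx, hx⟩

end IsTransitiveModelZFC

/-! ### Finite relational languages and their structures -/

/-- Finitely many relation symbols, with arities and pairwise distinct names. -/
structure RelLang (ι : Type) where
  ar : ι → ℕ
  nm : ι → ℕ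
  nm_inj : Function.Injective nm

namespace RelLang

variable {ι : Type} (Λ : RelLang ι)

/-- The relation symbol with index `i`. -/
def sym (i : ι) : ZFSet.{u} := relSym (num (Λ.ar i)) (num (Λ.nm i))

theorem relSym_eq_sym {n a : ZFSet.{u}} {i : ι} :
    relSym n a = Λ.sym i ↔ n = num (Λ.ar i) ∧ a = num (Λ.nm i) := by
  simp [sym, relSym, ZFSet.pair_inj]

theorem sym_injective : Function.Injective Λ.sym := fun _ _ h =>
  Λ.nm_inj (num_injective (Λ.relSym_eq_sym.1 h).2)

/-- The language as a set. -/
noncomputable def lang : ZFSet.{u} := ZFSet.range Λ.sym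

theorem sym_mem_lang (i : ι) : Λ.sym i ∈ Λ.lang := ZFSet.mem_range.2 ⟨i, rfl⟩

theorem relSym_mem_lang {n a : ZFSet.{u}} (h : relSym n a ∈ Λ.lang) :
    ∃ i, n = num (Λ.ar i) ∧ a = num (Λ.nm i) := by
  obtain ⟨i, hi⟩ := ZFSet.mem_range.1 h
  exact ⟨i, Λ.relSym_eq_sym.1 hi.symm⟩

theorem funSym_notMem_lang (n a : ZFSet.{u}) : funSym n a ∉ Λ.lang := by
  intro h
  obtain ⟨i, hi⟩ := ZFSet.mem_range.1 h
  have : (∅ : ZFSet.{u}) = {∅} := (ZFSet.pair_inj.1 hi).1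
  have h' : (∅ : ZFSet.{u}) ∈ ({∅} : ZFSet.{u}) := ZFSet.mem_singleton.2 rfl
  rw [← this] at h'
  exact ZFSet.notMem_empty _ h'

theorem isLanguage_lang : IsLanguage Λ.lang := by
  intro s hs
  obtain ⟨i, rfl⟩ := ZFSet.mem_range.1 hs
  exact ⟨_, num_mem_omega _, _, Or.inl rfl⟩

/-- The structure with domain `D` in which the symbol with index `i` is interpreted as `v i`. -/
noncomputable def str (D : ZFSet.{u}) (v : ι → ZFSet.{u}) : Str.{u} :=
  ⟨D, ZFSet.range fun i => ZFSet.pair (Λ.sym i) (v i)⟩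

variable {Λ}

theorem interprets_str {D : ZFSet.{u}} {v : ι → ZFSet.{u}} {i : ι} {w : ZFSet.{u}} :
    (Λ.str D v).Interprets (Λ.sym i) w ↔ w = v i := by
  simp only [Str.Interprets, str, ZFSet.mem_range, ZFSet.pair_inj]
  constructor
  · rintro ⟨j, hj, rfl⟩
    rw [Λ.sym_injective hj]
  · rintro rfl
    exact ⟨i, rfl, rfl⟩

theorem interprets_self (D : ZFSet.{u}) (v : ι → ZFSet.{u}) (i : ι) :
    (Λ.str D v).Interprets (Λ.sym i) (v i) :=
  interprets_str.2 rfl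

theorem eq_of_interprets {D : ZFSet.{u}} {v : ι → ZFSet.{u}} {i : ι} {w : ZFSet.{u}}
    (h : (Λ.str D v).Interprets (relSym (num (Λ.ar i)) (num (Λ.nm i))) w) : w = v i :=
  interprets_str.1 h

theorem str_inj {D E : ZFSet.{u}} {v w : ι → ZFSet.{u}} :
    Λ.str D v = Λ.str E w ↔ D = E ∧ v = w := by
  constructor
  · intro h
    refine ⟨congrArg Str.dom h, funext fun i => ?_⟩
    have := interprets_self (Λ := Λ) D v i
    rw [h] at this
    exact interprets_str.1 this
  · rintro ⟨rfl, rfl⟩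
    rfl

theorem isStr_str {D : ZFSet.{u}} {v : ι → ZFSet.{u}} (hD : D.Nonempty)
    (hv : ∀ i, v i ⊆ ZFSet.funs (num (Λ.ar i)) D) : IsStr Λ.lang (Λ.str D v) where
  nonempty := hD
  interp_subset p hp := by
    obtain ⟨i, rfl⟩ := ZFSet.mem_range.1 hp
    exact ⟨_, Λ.sym_mem_lang i, _, rfl⟩
  interp_unique s hs := by
    obtain ⟨i, rfl⟩ := ZFSet.mem_range.1 hs
    exact ⟨v i, interprets_str.2 rfl, fun w hw => interprets_str.1 hw⟩
  rel n a w h hw := by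
    obtain ⟨i, rfl, rfl⟩ := Λ.relSym_mem_lang h
    rw [eq_of_interprets hw]
    exact hv i
  func n a w h := absurd h (Λ.funSym_notMem_lang n a)

/-- `interp_subset` forbids stray elements in `interp`, so a structure is determined as a set by its
domain and the values of its symbols. Arguments about arbitrary structures can therefore use the
normal form `Λ.str`. -/
theorem _root_.NatDef.IsStr.exists_eq_str {A : Str.{u}} (h : IsStr Λ.lang A) :
    ∃ v, A = Λ.str A.dom v ∧ ∀ i, v i ⊆ ZFSet.funs (num (Λ.ar i)) A.dom := by
  choose v hv hu using fun i => h.interp_unique _ (Λ.sym_mem_lang i)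
  refine ⟨v, Str.ext rfl ?_, fun i => h.rel _ _ _ (Λ.sym_mem_lang i) (hv i)⟩
  ext p
  rw [str, ZFSet.mem_range]
  constructor
  · intro hp
    obtain ⟨s, hs, w, rfl⟩ := h.interp_subset p hp
    obtain ⟨i, rfl⟩ := ZFSet.mem_range.1 hs
    exact ⟨i, by rw [hu i w hp]⟩
  · rintro ⟨i, rfl⟩
    exact hv i

theorem isIso_str_iff {D E f : ZFSet.{u}} {v w : ι → ZFSet.{u}} :
    IsIso Λ.lang (Λ.str D v) (Λ.str E w) f ↔
      IsBij D E f ∧ ∀ i, ∀ t ∈ ZFSet.funs (num (Λ.ar i)) D, t ∈ v i ↔ comp f t ∈ w i := by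
  constructor
  · intro h
    exact ⟨h.bij, fun i => h.rel _ _ _ _ (Λ.sym_mem_lang i) (interprets_self _ _ i)
      (interprets_self _ _ i)⟩
  · rintro ⟨hf, h⟩
    refine ⟨hf, fun n a x y hs hx hy => ?_, fun n a x y hs => absurd hs (Λ.funSym_notMem_lang n a)⟩
    obtain ⟨i, rfl, rfl⟩ := Λ.relSym_mem_lang hs
    rw [eq_of_interprets hx, eq_of_interprets hy]
    exact h i

theorem isIso_str_iff_of_isGraphOn {D E f : ZFSet.{u}} {v w : ι → ZFSet.{u}}
    {F : ZFSet.{u} → ZFSet.{u}} (hF : BijOn F D E) (hf : IsGraphOn F D f) :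
    IsIso Λ.lang (Λ.str D v) (Λ.str E w) f ↔ ∀ i, ∀ t : Fin (Λ.ar i) → ZFSet.{u},
      (∀ j, t j ∈ D) → (tup t ∈ v i ↔ (tup fun j => F (t j)) ∈ w i) := by
  rw [isIso_str_iff, and_iff_right (hF.isBij hf)]
  refine forall_congr' fun i => ⟨fun h t ht => ?_, fun h t ht => ?_⟩
  · rw [h _ (tup_mem_funs.2 ht), comp_tup hf ht]
  · obtain ⟨t, ht', rfl⟩ := exists_tup ht
    rw [h t ht', comp_tup hf ht']

theorem isIso_idOn (D : ZFSet.{u}) (v : ι → ZFSet.{u}) :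
    IsIso Λ.lang (Λ.str D v) (Λ.str D v) (idOn D) :=
  (isIso_str_iff_of_isGraphOn (BijOn.id D) (isGraphOn_idOn D)).2 fun _ _ _ => Iff.rfl

variable {M : Set ZFSet.{u}} {α : Type}

theorem sym_mem (hM : IsTransitiveModelZFC M) (i : ι) : Λ.sym i ∈ M :=
  hM.pair_mem hM.empty_mem (hM.pair_mem (hM.num_mem _) (hM.num_mem _))

theorem lang_mem [Finite ι] (hM : IsTransitiveModelZFC M) : Λ.lang ∈ M := hM.range_mem fun i => sym_mem hM i

theorem str_code_mem [Finite ι] (hM : IsTransitiveModelZFC M) {D : ZFSet.{u}} {v : ι → ZFSet.{u}} :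
    (Λ.str D v).code ∈ M ↔ D ∈ M ∧ ∀ i, v i ∈ M := by
  constructor
  · intro h
    obtain ⟨hD, hI⟩ := hM.of_pair_mem h
    exact ⟨hD, fun i => (hM.of_pair_mem (hM.mem_of_mem hI (interprets_self D v i))).2⟩
  · rintro ⟨hD, hv⟩
    exact hM.pair_mem hD (hM.range_mem fun i => hM.pair_mem (sym_mem hM i) (hv i))

theorem defF_str_code [Finite ι] (hM : IsTransitiveModelZFC M) {f : (α → M) → ZFSet.{u}}
    {g : ι → (α → M) → ZFSet.{u}} (hf : DefF f) (hg : ∀ i, DefF (g i)) :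
    DefF fun v => (Λ.str (f v) fun i => g i v).code :=
  hM.defF_pair hf <| hM.defF_range fun i => hM.defF_pair (.const (sym_mem hM i)) (hg i)

end RelLang

theorem Str.code_injective : Function.Injective Str.code := fun _ _ h =>
  Str.ext (ZFSet.pair_inj.1 h).1 (ZFSet.pair_inj.1 h).2

/-! ### Torsors of tuples -/

section Orbits

variable {Γ : Type} [Group Γ] {k : ℕ} (σ : Γ →* Equiv.Perm (Fin k))

/-- The set of all rearrangements of the tuple `t` by the permutations `σ g`. -/
noncomputable def orb (t : Fin k → ZFSet.{u}) : ZFSet.{u} :=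
  ZFSet.range fun g : Γ => tup fun i => t (σ g i)

theorem tup_mem_orb {t s : Fin k → ZFSet.{u}} : tup s ∈ orb σ t ↔ ∃ g, s = fun i => t (σ g i) := by
  simp only [orb, ZFSet.mem_range, tup_injective.eq_iff, eq_comm]

theorem orb_subset_funs {t : Fin k → ZFSet.{u}} {D : ZFSet.{u}} (h : ∀ i, t i ∈ D) :
    orb σ t ⊆ ZFSet.funs (num k) D := by
  intro x hx
  obtain ⟨g, rfl⟩ := ZFSet.mem_range.1 hx
  exact tup_mem_funs.2 fun i => h _

/-- The group permutes indices, hence acts on the right, and `g' ↦ g * g'` is a bijection of `Γ`.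
The torsor thus has no preferred base tuple. -/
theorem orb_translate (t : Fin k → ZFSet.{u}) (g : Γ) : (orb σ fun i => t (σ g i)) = orb σ t := by
  ext x
  simp only [orb, ZFSet.mem_range]
  constructor
  · rintro ⟨g', rfl⟩
    exact ⟨g * g', by simp⟩
  · rintro ⟨g', rfl⟩
    exact ⟨g⁻¹ * g', by simp⟩

/-- Maps act on the values of a tuple and the group on its indices, so the two actions commute. -/
theorem tup_map_mem_orb_iff {F : ZFSet.{u} → ZFSet.{u}} {D E : ZFSet.{u}} (hF : BijOn F D E)
    {t s : Fin k → ZFSet.{u}} (ht : ∀ i, t i ∈ D) (hs : ∀ i, s i ∈ D) :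
    tup s ∈ orb σ t ↔ (tup fun i => F (s i)) ∈ orb σ fun i => F (t i) := by
  rw [tup_mem_orb, tup_mem_orb]
  refine exists_congr fun g => ⟨fun h => by rw [h], fun h => funext fun i => ?_⟩
  exact hF.inj _ (hs i) _ (ht _) (congrFun h i)

theorem eq_orb_of_map {F : ZFSet.{u} → ZFSet.{u}} {D E : ZFSet.{u}} (hF : BijOn F D E)
    {t : Fin k → ZFSet.{u}} (ht : ∀ i, t i ∈ D) {r : ZFSet.{u}} (hr : r ⊆ ZFSet.funs (num k) E)
    (h : ∀ s : Fin k → ZFSet.{u}, (∀ i, s i ∈ D) →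
      (tup s ∈ orb σ t ↔ (tup fun i => F (s i)) ∈ r)) : r = orb σ fun i => F (t i) := by
  have key : ∀ s : Fin k → ZFSet.{u}, (∀ i, s i ∈ E) →
      (tup s ∈ r ↔ tup s ∈ orb σ fun i => F (t i)) := by
    intro s hs
    choose s' hs' hFs using fun i => hF.surj _ (hs i)
    obtain rfl : (fun i => F (s' i)) = s := funext hFs
    rw [← h s' hs', tup_map_mem_orb_iff σ hF ht hs']
  ext x
  constructor
  · intro hx
    obtain ⟨s, hs, rfl⟩ := exists_tup (hr hx)
    exact (key s hs).1 hx
  · intro hx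
    obtain ⟨s, hs, rfl⟩ := exists_tup (orb_subset_funs σ (fun i => hF.maps _ (ht i)) hx)
    exact (key s hs).2 hx

theorem self_mem_orb (t : Fin k → ZFSet.{u}) : tup t ∈ orb σ t :=
  (tup_mem_orb σ).2 ⟨1, by simp⟩

theorem IsTransitiveModelZFC.orb_mem [Finite Γ] {M : Set ZFSet.{u}} (hM : IsTransitiveModelZFC M)
    {t : Fin k → ZFSet.{u}} (ht : ∀ i, t i ∈ M) : orb σ t ∈ M :=
  hM.range_mem fun _ => hM.tup_mem fun _ => ht _

theorem IsTransitiveModelZFC.defF_orb [Finite Γ] {M : Set ZFSet.{u}} (hM : IsTransitiveModelZFC M)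
    {α : Type} {f : Fin k → (α → M) → ZFSet.{u}} (hf : ∀ i, DefF (f i)) :
    DefF fun v => orb σ fun i => f i v :=
  hM.defF_range fun _ => hM.defF_tup fun _ => hf _

end Orbits

/-! ### Constructions attached to a group extension -/

/-- A surjection `ν : G → H` of finite groups, an action of `H` on `n` points, and an
action of `G` on `n + m` points that extends the action on `n` points through `ν`. -/
structure GroupExt where
  n : ℕ
  m : ℕ
  G : Type
  H : Type
  [groupG : Group G]
  [groupH : Group H]
  [finiteG : Finite G]
  [finiteH : Finite H]
  ν : G →* H
  ν_surjective : Function.Surjective ν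
  ρ : H →* Equiv.Perm (Fin n)
  γ : G →* Equiv.Perm (Fin (n + m))
  ρ_injective : Function.Injective ρ
  γ_injective : Function.Injective γ
  γ_castAdd : ∀ g i, γ g (Fin.castAdd m i) = Fin.castAdd m (ρ (ν g) i)
  γ_natAdd : ∀ g j, ∃ j', γ g (Fin.natAdd n j) = Fin.natAdd n j'
  n_pos : 0 < n

namespace GroupExt

attribute [instance] groupG groupH finiteG finiteH

variable (Ξ : GroupExt)

/-- The relation symbols of the base structures: an `n`-ary one (`false`) and a binary one
(`true`). -/
def lowLang : RelLang Bool where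
  ar b := bif b then 2 else Ξ.n
  nm b := bif b then 2 else 1
  nm_inj := by decide

/-- The relation symbols of the structures in the graph: those of `lowLang`, the unary symbol
`Sum.inr false` for the base, and an `n + m`-ary symbol `Sum.inr true`. -/
def highLang : RelLang (Bool ⊕ Bool) where
  ar := Sum.elim Ξ.lowLang.ar fun b => bif b then Ξ.n + Ξ.m else 1
  -- The base symbols keep their names 1 and 2, so they are literally the same sets in both
  -- languages; 0 and 3 are fresh.
  nm := Sum.elim Ξ.lowLang.nm fun b => bif b then 3 else 0
  nm_inj := by
    intro x y h
    rcases x with (_ | _) | (_ | _) <;> rcases y with (_ | _) | (_ | _) <;>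
      first | rfl | exact absurd h (by simp [lowLang])

/-- The base structure on `D` with an `n`-ary relation `r` and a binary relation `e`. -/
noncomputable def base (D r e : ZFSet.{u}) : Str.{u} := Ξ.lowLang.str D fun b => bif b then e else r

/-- The structure on `X` with base on the subset `D` and an `n + m`-ary relation `R`. -/
noncomputable def total (X D r e R : ZFSet.{u}) : Str.{u} :=
  Ξ.highLang.str X (Sum.elim (fun b => bif b then e else r)
    fun b => bif b then R else ZFSet.funs (num 1) D)

variable {Ξ}

theorem base_inj {D r e D' r' e' : ZFSet.{u}} :
    Ξ.base D r e = Ξ.base D' r' e' ↔ D = D' ∧ r = r' ∧ e = e' := by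
  rw [base, base, RelLang.str_inj]
  refine and_congr_right fun _ => ⟨fun h => ⟨congrFun h false, congrFun h true⟩, ?_⟩
  rintro ⟨rfl, rfl⟩
  rfl

theorem funs_one_injective {D D' : ZFSet.{u}} (h : ZFSet.funs (num 1) D = ZFSet.funs (num 1) D') :
    D = D' := by
  ext x
  have : (tup fun _ : Fin 1 => x) ∈ ZFSet.funs (num 1) D ↔
    (tup fun _ : Fin 1 => x) ∈ ZFSet.funs (num 1) D' := by rw [h]
  rwa [tup_mem_funs, tup_mem_funs, forall_const, forall_const] at this

theorem total_inj {X D r e R X' D' r' e' R' : ZFSet.{u}}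
    (h : Ξ.total X D r e R = Ξ.total X' D' r' e' R') :
    X = X' ∧ D = D' ∧ r = r' ∧ e = e' ∧ R = R' := by
  obtain ⟨h₁, h₂⟩ := RelLang.str_inj.1 h
  exact ⟨h₁, funs_one_injective (congrFun h₂ (Sum.inr false)), congrFun h₂ (Sum.inl false),
    congrFun h₂ (Sum.inl true), congrFun h₂ (Sum.inr true)⟩

theorem isStr_base {D r e : ZFSet.{u}} (hD : D.Nonempty) (hr : r ⊆ ZFSet.funs (num Ξ.n) D)
    (he : e ⊆ ZFSet.funs (num 2) D) : IsStr Ξ.lowLang.lang (Ξ.base D r e) :=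
  RelLang.isStr_str hD fun b => by cases b <;> assumption

theorem exists_eq_base {A : Str.{u}} (h : IsStr Ξ.lowLang.lang A) :
    ∃ r e, A = Ξ.base A.dom r e ∧ r ⊆ ZFSet.funs (num Ξ.n) A.dom ∧
      e ⊆ ZFSet.funs (num 2) A.dom := by
  obtain ⟨v, hv, hs⟩ := h.exists_eq_str
  refine ⟨v false, v true, hv.trans ?_, hs false, hs true⟩
  congr 1
  funext b
  cases b <;> rfl

theorem funs_mono {n : ℕ} {D E : ZFSet.{u}} (h : D ⊆ E) :
    ZFSet.funs (num n) D ⊆ ZFSet.funs (num n) E := by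
  intro x hx
  obtain ⟨t, ht, rfl⟩ := exists_tup hx
  exact tup_mem_funs.2 fun i => h (ht i)

theorem isStr_total {X D r e R : ZFSet.{u}} (hX : X.Nonempty) (hDX : D ⊆ X)
    (hr : r ⊆ ZFSet.funs (num Ξ.n) D) (he : e ⊆ ZFSet.funs (num 2) D)
    (hR : R ⊆ ZFSet.funs (num (Ξ.n + Ξ.m)) X) :
    IsStr Ξ.highLang.lang (Ξ.total X D r e R) :=
  RelLang.isStr_str hX fun b => by
    rcases b with (_ | _) | (_ | _)
    · exact hr.trans (funs_mono hDX)
    · exact he.trans (funs_mono hDX)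
    · exact funs_mono hDX
    · exact hR

theorem isIso_base_iff {D E f r e r' e' : ZFSet.{u}} {F : ZFSet.{u} → ZFSet.{u}}
    (hF : BijOn F D E) (hf : IsGraphOn F D f) :
    IsIso Ξ.lowLang.lang (Ξ.base D r e) (Ξ.base E r' e') f ↔
      (∀ t : Fin Ξ.n → ZFSet.{u}, (∀ j, t j ∈ D) → (tup t ∈ r ↔ (tup fun j => F (t j)) ∈ r')) ∧
      ∀ t : Fin 2 → ZFSet.{u}, (∀ j, t j ∈ D) → (tup t ∈ e ↔ (tup fun j => F (t j)) ∈ e') := by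
  rw [base, base, RelLang.isIso_str_iff_of_isGraphOn hF hf, Bool.forall_bool]
  exact Iff.rfl

theorem isIso_total_iff {X Y f D r e R D' r' e' R' : ZFSet.{u}} {F : ZFSet.{u} → ZFSet.{u}}
    (hF : BijOn F X Y) (hf : IsGraphOn F X f) :
    IsIso Ξ.highLang.lang (Ξ.total X D r e R) (Ξ.total Y D' r' e' R') f ↔
      ((∀ t : Fin Ξ.n → ZFSet.{u}, (∀ j, t j ∈ X) → (tup t ∈ r ↔ (tup fun j => F (t j)) ∈ r')) ∧
      ∀ t : Fin 2 → ZFSet.{u}, (∀ j, t j ∈ X) → (tup t ∈ e ↔ (tup fun j => F (t j)) ∈ e')) ∧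
      (∀ t : Fin 1 → ZFSet.{u}, (∀ j, t j ∈ X) →
        (tup t ∈ ZFSet.funs (num 1) D ↔ (tup fun j => F (t j)) ∈ ZFSet.funs (num 1) D')) ∧
      ∀ t : Fin (Ξ.n + Ξ.m) → ZFSet.{u}, (∀ j, t j ∈ X) →
        (tup t ∈ R ↔ (tup fun j => F (t j)) ∈ R') := by
  rw [total, total, RelLang.isIso_str_iff_of_isGraphOn hF hf, Sum.forall, Bool.forall_bool,
    Bool.forall_bool]
  exact Iff.rfl

theorem predSet_total {X D r e R : ZFSet.{u}} (hDX : D ⊆ X) :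
    (Ξ.total X D r e R).predSet (Ξ.highLang.sym (Sum.inr false)) = D := by
  ext b
  rw [Str.predSet, ZFSet.mem_sep]
  constructor
  · rintro ⟨-, v, hv, hb⟩
    rw [RelLang.interprets_str.1 hv, singleton_pair_eq_tup] at hb
    exact tup_mem_funs.1 hb 0
  · intro hb
    refine ⟨hDX hb, _, RelLang.interprets_str.2 rfl, ?_⟩
    rw [singleton_pair_eq_tup]
    exact tup_mem_funs.2 fun _ => hb

/-- Since `r` and `e` consist of tuples from `D`, nothing is cut off when passing to the base. -/
theorem isMinus_total_iff {X D r e R : ZFSet.{u}} {A : Str.{u}} (hD : D.Nonempty) (hDX : D ⊆ X)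
    (hr : r ⊆ ZFSet.funs (num Ξ.n) D) (he : e ⊆ ZFSet.funs (num 2) D) :
    IsMinus Ξ.lowLang.lang (Ξ.highLang.sym (Sum.inr false)) (Ξ.total X D r e R) A ↔
      A = Ξ.base D r e := by
  constructor
  · intro h
    obtain ⟨r', e', hA, hr', he'⟩ := exists_eq_base h.isStr
    have hdom : A.dom = D := h.dom_eq.trans (predSet_total hDX)
    rw [hA, base_inj]
    rw [hdom] at hr' he'
    refine ⟨hdom, ?_, ?_⟩
    · have := h.rel _ _ r' r (Ξ.lowLang.sym_mem_lang false)
        (hA ▸ RelLang.interprets_self _ _ false) (RelLang.interprets_self _ _ (Sum.inl false))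
      rw [hdom] at this
      ext t
      exact ⟨fun ht => (this t (hr' ht)).1 ht, fun ht => (this t (hr ht)).2 ht⟩
    · have := h.rel _ _ e' e (Ξ.lowLang.sym_mem_lang true)
        (hA ▸ RelLang.interprets_self _ _ true) (RelLang.interprets_self _ _ (Sum.inl true))
      rw [hdom] at this
      ext t
      exact ⟨fun ht => (this t (he' ht)).1 ht, fun ht => (this t (he ht)).2 ht⟩
  · rintro rfl
    refine ⟨isStr_base hD hr he, (predSet_total hDX).symm, fun n a v w hs hv hw t _ => ?_,
      fun n a v w hs => absurd hs (Ξ.lowLang.funSym_notMem_lang n a)⟩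
    obtain ⟨i, rfl, rfl⟩ := Ξ.lowLang.relSym_mem_lang hs
    rw [RelLang.eq_of_interprets hv,
      RelLang.eq_of_interprets (Λ := Ξ.highLang) (i := Sum.inl i) hw]
    rfl

/-! ### Extensions of a base by `m` new points -/

/-- The enumeration `t` of `n + m` points exhibits `X` as the extension of `D` by `m` new points,
with `r` and `R` the torsors generated by the two parts of `t`. -/
structure Enumerates (Ξ : GroupExt) (X D r R : ZFSet.{u}) (t : Fin (Ξ.n + Ξ.m) → ZFSet.{u}) :
    Prop where
  inj : Function.Injective t
  low : ∀ i, t (Fin.castAdd Ξ.m i) ∈ D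
  high : ∀ j, t (Fin.natAdd Ξ.n j) ∉ D
  r_eq : r = orb Ξ.ρ fun i => t (Fin.castAdd Ξ.m i)
  R_eq : R = orb Ξ.γ t
  mem_iff : ∀ x, x ∈ X ↔ x ∈ D ∨ ∃ j, x = t (Fin.natAdd Ξ.n j)

namespace Enumerates

variable {X D r R : ZFSet.{u}} {t : Fin (Ξ.n + Ξ.m) → ZFSet.{u}}

theorem subset (h : Ξ.Enumerates X D r R t) : D ⊆ X := fun x hx => (h.mem_iff x).2 (Or.inl hx)

theorem mem (h : Ξ.Enumerates X D r R t) (i : Fin (Ξ.n + Ξ.m)) : t i ∈ X := by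
  induction i using Fin.addCases with
  | left i => exact h.subset (h.low i)
  | right j => exact (h.mem_iff _).2 (Or.inr ⟨j, rfl⟩)

theorem nonempty (h : Ξ.Enumerates X D r R t) : D.Nonempty := ⟨_, h.low ⟨0, Ξ.n_pos⟩⟩

theorem r_subset (h : Ξ.Enumerates X D r R t) : r ⊆ ZFSet.funs (num Ξ.n) D :=
  h.r_eq ▸ orb_subset_funs _ h.low

theorem R_subset (h : Ξ.Enumerates X D r R t) : R ⊆ ZFSet.funs (num (Ξ.n + Ξ.m)) X :=
  h.R_eq ▸ orb_subset_funs _ h.mem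

/-- Replaces the lower part of an enumeration by its translate under `ν g`; as `ν` is onto, the
lower part can be made any prescribed tuple of `r`. -/
theorem translate (h : Ξ.Enumerates X D r R t) (g : Ξ.G) :
    Ξ.Enumerates X D r R fun i => t (Ξ.γ g i) where
  inj := h.inj.comp (Ξ.γ g).injective
  low i := by rw [Ξ.γ_castAdd]; exact h.low _
  high j := by
    obtain ⟨j', hj'⟩ := Ξ.γ_natAdd g j
    rw [hj']
    exact h.high _
  r_eq := by
    simp only [Ξ.γ_castAdd]
    rw [orb_translate Ξ.ρ fun i => t (Fin.castAdd Ξ.m i), h.r_eq]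
  R_eq := by rw [orb_translate, h.R_eq]
  mem_iff x := by
    rw [h.mem_iff]
    refine or_congr_right ⟨?_, ?_⟩
    · rintro ⟨j, rfl⟩
      obtain ⟨j', hj'⟩ := Ξ.γ_natAdd g⁻¹ j
      exact ⟨j', by simp [← hj']⟩
    · rintro ⟨j, rfl⟩
      obtain ⟨j', hj'⟩ := Ξ.γ_natAdd g j
      exact ⟨j', by rw [hj']⟩

end Enumerates

/-- Some enumeration exhibits `X` as an extension of `D`. -/
def Extends (Ξ : GroupExt) (X D r R : ZFSet.{u}) : Prop := ∃ t, Ξ.Enumerates X D r R t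

/-! ### Definability of extensions and of their codes -/

variable {M : Set ZFSet.{u}} {α : Type}

theorem def_injective {k : ℕ} {f : Fin k → (α → M) → ZFSet.{u}} (hf : ∀ i, DefF (f i)) :
    Def fun v => Function.Injective fun i => f i v :=
  (Def.forall_index fun i => Def.forall_index fun j =>
    (Def.eq (hf i) (hf j)).imp (Def.const (i = j))).congr fun _ => Iff.rfl

theorem def_enumerates (hM : IsTransitiveModelZFC M) {X D r R : (α → M) → ZFSet.{u}}
    {t : Fin (Ξ.n + Ξ.m) → (α → M) → ZFSet.{u}} (hX : DefF X) (hD : DefF D) (hr : DefF r)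
    (hR : DefF R) (ht : ∀ i, DefF (t i)) :
    Def fun v => Ξ.Enumerates (X v) (D v) (r v) (R v) fun i => t i v := by
  refine ((def_injective ht).and <| (Def.forall_index fun i : Fin Ξ.n => Def.mem (ht (Fin.castAdd Ξ.m i)) hD).and <|
    (Def.forall_index fun j : Fin Ξ.m => (Def.mem (ht (Fin.natAdd Ξ.n j)) hD).not).and <|
    (Def.eq hr (hM.defF_orb Ξ.ρ fun i => ht (Fin.castAdd Ξ.m i))).and <|
    (Def.eq hR (hM.defF_orb Ξ.γ ht)).and <|
    Def.all (p := fun v x => x ∈ X v ↔ x ∈ D v ∨ ∃ j, x = t (Fin.natAdd Ξ.n j) v) <|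
      (Def.mem (.var _) (hX.reindex _)).iff <| (Def.mem (.var _) (hD.reindex _)).or <|
        Def.exists_index fun j => Def.eq (.var _) ((ht (Fin.natAdd Ξ.n j)).reindex _)).congr fun v => ?_
  constructor
  · intro h
    exact ⟨h.inj, h.low, h.high, h.r_eq, h.R_eq, fun x _ => h.mem_iff x⟩
  · rintro ⟨h₁, h₂, h₃, h₄, h₅, h₆⟩
    refine ⟨h₁, h₂, h₃, h₄, h₅, fun x => ⟨fun hx => (h₆ x (hM.mem_of_mem (hX.1 v) hx)).1 hx,
      fun hx => (h₆ x ?_).2 hx⟩⟩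
    rcases hx with hx | ⟨j, rfl⟩
    · exact hM.mem_of_mem (hD.1 v) hx
    · exact (ht _).1 v

theorem def_extends (hM : IsTransitiveModelZFC M) {X D r R : (α → M) → ZFSet.{u}}
    (hX : DefF X) (hD : DefF D) (hr : DefF r) (hR : DefF R) :
    Def fun v => Ξ.Extends (X v) (D v) (r v) (R v) := by
  refine (Def.exists_block (p := fun v t => Ξ.Enumerates (X v) (D v) (r v) (R v) t) <|
    def_enumerates hM (hX.reindex _) (hD.reindex _) (hr.reindex _) (hR.reindex _)
      fun i => .var _).congr fun v => ?_
  constructor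
  · rintro ⟨t, ht⟩
    exact ⟨t, fun i => hM.mem_of_mem (hX.1 v) (ht.mem i), ht⟩
  · rintro ⟨t, _, ht⟩
    exact ⟨t, ht⟩

theorem funs_one_mem (hM : IsTransitiveModelZFC M) {D : ZFSet.{u}} (hD : D ∈ M) :
    ZFSet.funs (num 1) D ∈ M := by
  obtain ⟨y, hy, h⟩ := hM.exists_image (F := fun d => tup fun _ : Fin 1 => d)
    (hM.defF_tup fun _ => .var 0) hD
  convert hy
  ext z
  rw [h]
  constructor
  · intro hz
    obtain ⟨t, ht, rfl⟩ := exists_tup hz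
    exact ⟨t 0, ht 0, by congr 1; funext i; rw [Subsingleton.elim i 0]⟩
  · rintro ⟨d, hd, rfl⟩
    exact tup_mem_funs.2 fun _ => hd

theorem defF_funs_one (hM : IsTransitiveModelZFC M) {f : (α → M) → ZFSet.{u}} (hf : DefF f) :
    DefF fun v => ZFSet.funs (num 1) (f v) := by
  refine hM.defF_of_mem (fun v => funs_one_mem hM (hf.1 v)) ?_
  refine (Def.exMem (p := fun w d => (w none : ZFSet.{u}) = tup fun _ : Fin 1 => d)
    (hf.reindex some) hM.transitive ?_).congr fun w => ?_
  · exact Def.eq (.var _) (hM.defF_tup fun _ => .var _)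
  · constructor
    · intro hz
      obtain ⟨t, ht, hz⟩ := exists_tup hz
      exact ⟨t 0, ht 0, by rw [hz]; congr 1; funext i; rw [Subsingleton.elim i 0]⟩
    · rintro ⟨d, hd, h⟩
      rw [h]
      exact tup_mem_funs.2 fun _ => hd

theorem defF_base (hM : IsTransitiveModelZFC M) {D r e : (α → M) → ZFSet.{u}} (hD : DefF D)
    (hr : DefF r) (he : DefF e) : DefF fun v => (Ξ.base (D v) (r v) (e v)).code :=
  RelLang.defF_str_code hM (g := fun b v => bif b then e v else r v) hD fun b => by
    cases b <;> assumption

theorem defF_total (hM : IsTransitiveModelZFC M) {X D r e R : (α → M) → ZFSet.{u}}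
    (hX : DefF X) (hD : DefF D) (hr : DefF r) (he : DefF e) (hR : DefF R) :
    DefF fun v => (Ξ.total (X v) (D v) (r v) (e v) (R v)).code :=
  RelLang.defF_str_code hM (g := fun b v => Sum.elim (fun b => bif b then e v else r v)
    (fun b => bif b then R v else ZFSet.funs (num 1) (D v)) b) hX fun b => by
    rcases b with (_ | _) | (_ | _)
    exacts [hr, he, defF_funs_one hM hD, hR]

theorem base_code_mem (hM : IsTransitiveModelZFC M) {D r e : ZFSet.{u}} :
    (Ξ.base D r e).code ∈ M ↔ D ∈ M ∧ r ∈ M ∧ e ∈ M := by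
  rw [base, RelLang.str_code_mem hM, Bool.forall_bool]
  exact Iff.rfl

theorem total_code_mem (hM : IsTransitiveModelZFC M) {X D r e R : ZFSet.{u}} (hX : X ∈ M)
    (hD : D ∈ M) (hr : r ∈ M) (he : e ∈ M) (hR : R ∈ M) : (Ξ.total X D r e R).code ∈ M := by
  rw [total, RelLang.str_code_mem hM]
  refine ⟨hX, fun b => ?_⟩
  rcases b with (_ | _) | (_ | _)
  exacts [hr, he, funs_one_mem hM hD, hR]

/-- A definable isomorphism-closed class of base structures on which the `n`-ary relation is
a torsor. -/
structure BaseClass (Ξ : GroupExt) (M : Set ZFSet.{u}) where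
  K : ZFSet.{u} → ZFSet.{u} → ZFSet.{u} → Prop
  definable : Def fun v : Fin 3 → M => K (v 0) (v 1) (v 2)
  exists_tuple : ∀ D r e, K D r e → ∃ t : Fin Ξ.n → ZFSet.{u}, Function.Injective t ∧
    (∀ i, t i ∈ D) ∧ r = orb Ξ.ρ t
  e_subset : ∀ D r e, K D r e → e ⊆ ZFSet.funs (num 2) D
  iso : ∀ D r e D' r' e', K D r e → D ∈ M → r' ⊆ ZFSet.funs (num Ξ.n) D' →
    e' ⊆ ZFSet.funs (num 2) D' → D' ∈ M → ∀ f ∈ M,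
    IsIso Ξ.lowLang.lang (Ξ.base D r e) (Ξ.base D' r' e') f → K D' r' e'

/-- Every member of the class has an extension. -/
theorem BaseClass.exists_extends (hM : IsTransitiveModelZFC M) (𝒦 : Ξ.BaseClass M)
    {D r e : ZFSet.{u}} (h : 𝒦.K D r e) (hD : D ∈ M) :
    ∃ X ∈ M, ∃ R ∈ M, Ξ.Extends X D r R := by
  obtain ⟨s, hs, hsD, hr⟩ := 𝒦.exists_tuple D r e h
  -- Pairs with first entry `D` have rank above that of `D`, so they cannot lie in `D`.
  let new : Fin Ξ.m → ZFSet.{u} := fun j => ZFSet.pair D (num j)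
  have hnew : ∀ j, new j ∉ D := fun j hj => by
    have h₁ : D ∈ ({D} : ZFSet.{u}) := ZFSet.mem_singleton.2 rfl
    have h₂ : ({D} : ZFSet.{u}) ∈ new j := by simp [new, ZFSet.pair]
    exact ((ZFSet.rank_lt_of_mem h₁).trans (ZFSet.rank_lt_of_mem h₂)).not_gt
      (ZFSet.rank_lt_of_mem hj)
  have hnewM : ∀ j, new j ∈ M := fun j => hM.pair_mem hD (hM.num_mem j)
  have hinj : Function.Injective new := fun i j hij =>
    Fin.ext (num_injective (ZFSet.pair_inj.1 hij).2)
  let t : Fin (Ξ.n + Ξ.m) → ZFSet.{u} := Fin.append s new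
  have htM : ∀ i, t i ∈ M := fun i => by
    induction i using Fin.addCases with
    | left i => simpa [t] using hM.mem_of_mem hD (hsD i)
    | right j => simpa [t] using hnewM j
  refine ⟨D ∪ ZFSet.range new, hM.union_mem hD (hM.range_mem hnewM), orb Ξ.γ t,
    hM.orb_mem _ htM, t, ?_, fun i => ?_, fun j => ?_, ?_, rfl, fun x => ?_⟩
  · refine Fin.append_injective_iff.2 ⟨hs, hinj, fun i j h => hnew j (h ▸ hsD i)⟩
  · simpa [t] using hsD i
  · simpa [t] using hnew j
  · simpa [t] using hr
  · simp [t, eq_comm]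

/-- Isomorphisms of the bases lift to extensions. -/
theorem exists_lift (hM : IsTransitiveModelZFC M) {X D r e R Y D' r' e' R' f : ZFSet.{u}}
    (hX : Ξ.Extends X D r R) (hY : Ξ.Extends Y D' r' R') (he : e ⊆ ZFSet.funs (num 2) D)
    (he' : e' ⊆ ZFSet.funs (num 2) D') (hXM : X ∈ M) (hYM : Y ∈ M) (hfM : f ∈ M)
    (hf : IsIso Ξ.lowLang.lang (Ξ.base D r e) (Ξ.base D' r' e') f) :
    ∃ g ∈ M, IsIso Ξ.highLang.lang (Ξ.total X D r e R) (Ξ.total Y D' r' e' R') g ∧ f ⊆ g := by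
  classical
  obtain ⟨t, ht⟩ := hX
  obtain ⟨F, hF, hfF⟩ := hf.bij.exists_bijOn
  change BijOn F D D' at hF
  change IsGraphOn F D f at hfF
  rw [isIso_base_iff hF hfF] at hf
  -- The image under `F` of the lower part of `t` lies in the torsor `r'`, so it differs from the
  -- lower part of any enumeration of `Y` by some `h` in `H`. Lifting `h` to `G` corrects that
  -- enumeration; this is where surjectivity of `ν` is used.
  obtain ⟨t', ht', htt'⟩ : ∃ t', Ξ.Enumerates Y D' r' R' t' ∧
      ∀ i, F (t (Fin.castAdd Ξ.m i)) = t' (Fin.castAdd Ξ.m i) := by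
    obtain ⟨t', ht'⟩ := hY
    have h₁ := (hf.1 _ ht.low).1 (ht.r_eq ▸ self_mem_orb _ _)
    rw [ht'.r_eq, tup_mem_orb] at h₁
    obtain ⟨h, hh⟩ := h₁
    obtain ⟨g, rfl⟩ := Ξ.ν_surjective h
    exact ⟨_, ht'.translate g, fun i => by rw [Ξ.γ_castAdd]; exact congrFun hh i⟩
  have hlow : ∀ j, t (Fin.natAdd Ξ.n j) ∉ D := ht.high
  let F' : ZFSet.{u} → ZFSet.{u} := fun x =>
    if x ∈ D then F x else if h : ∃ j, x = t (Fin.natAdd Ξ.n j) then t' (Fin.natAdd Ξ.n h.choose)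
    else ∅
  have hF'D : ∀ x ∈ D, F' x = F x := fun x hx => if_pos hx
  have hF'new : ∀ j, F' (t (Fin.natAdd Ξ.n j)) = t' (Fin.natAdd Ξ.n j) := fun j => by
    have h : ∃ j', t (Fin.natAdd Ξ.n j) = t (Fin.natAdd Ξ.n j') := ⟨j, rfl⟩
    simp only [F', if_neg (ht.high j), dif_pos h]
    rw [← (Fin.natAdd_injective _ _ (ht.inj h.choose_spec))]
  have hF't : ∀ i, F' (t i) = t' i := fun i => by
    induction i using Fin.addCases with
    | left i => rw [hF'D _ (ht.low i), htt']
    | right j => exact hF'new j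
  have hmem : ∀ x ∈ X, F' x ∈ D' ↔ x ∈ D := fun x hx => by
    rcases (ht.mem_iff x).1 hx with hx | ⟨j, rfl⟩
    · simp [hF'D x hx, hF.maps x hx, hx]
    · simp [hF'new, ht.high, ht'.high]
  have hbij : BijOn F' X Y := by
    refine ⟨fun x hx => ?_, fun x hx y hy hxy => ?_, fun y hy => ?_⟩
    · rcases (ht.mem_iff x).1 hx with hx | ⟨j, rfl⟩
      · rw [hF'D x hx]
        exact ht'.subset (hF.maps x hx)
      · rw [hF'new]
        exact ht'.mem _
    · have hiff : x ∈ D ↔ y ∈ D := by rw [← hmem x hx, hxy, hmem y hy]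
      rcases (ht.mem_iff x).1 hx with hx | ⟨j, rfl⟩
      · have hy := hiff.1 hx
        rw [hF'D x hx, hF'D y hy] at hxy
        exact hF.inj x hx y hy hxy
      · rcases (ht.mem_iff y).1 hy with hy | ⟨j', rfl⟩
        · exact absurd (hiff.2 hy) (ht.high j)
        · rw [hF'new, hF'new] at hxy
          rw [ht'.inj hxy]
    · rcases (ht'.mem_iff y).1 hy with hy | ⟨j, rfl⟩
      · obtain ⟨x, hx, rfl⟩ := hF.surj y hy
        exact ⟨x, ht.subset hx, hF'D x hx⟩
      · exact ⟨_, ht.mem _, hF'new j⟩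
  let g : ZFSet.{u} := f ∪ ZFSet.range fun j =>
    ZFSet.pair (t (Fin.natAdd Ξ.n j)) (t' (Fin.natAdd Ξ.n j))
  have hg : IsGraphOn F' X g := by
    intro p
    simp only [g, ZFSet.mem_union, ZFSet.mem_range, hfF p]
    constructor
    · rintro (⟨x, hx, rfl⟩ | ⟨j, rfl⟩)
      · exact ⟨x, ht.subset hx, by rw [hF'D x hx]⟩
      · exact ⟨_, ht.mem _, by rw [hF'new]⟩
    · rintro ⟨x, hx, rfl⟩
      rcases (ht.mem_iff x).1 hx with hx | ⟨j, rfl⟩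
      · exact Or.inl ⟨x, hx, by rw [hF'D x hx]⟩
      · exact Or.inr ⟨j, by rw [hF'new]⟩
  -- Relations of the base contain only tuples from `D`, and `F'` both preserves and reflects
  -- membership in the base, so tuples meeting the new points are excluded on both sides.
  have htrans : ∀ {k : ℕ} {v w : ZFSet.{u}}, v ⊆ ZFSet.funs (num k) D →
      w ⊆ ZFSet.funs (num k) D' → (∀ s : Fin k → ZFSet.{u}, (∀ j, s j ∈ D) →
        (tup s ∈ v ↔ (tup fun j => F (s j)) ∈ w)) →
      ∀ s : Fin k → ZFSet.{u}, (∀ j, s j ∈ X) → (tup s ∈ v ↔ (tup fun j => F' (s j)) ∈ w) := by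
    intro k v w hv hw h s hs
    by_cases hsD : ∀ j, s j ∈ D
    · rw [h s hsD]
      simp only [hF'D _ (hsD _)]
    · refine iff_of_false (fun hsv => hsD (tup_mem_funs.1 (hv hsv))) fun hsw => hsD fun j => ?_
      exact (hmem _ (hs j)).1 (tup_mem_funs.1 (hw hsw) j)
  refine ⟨g, hM.union_mem hfM (hM.range_mem fun j => hM.pair_mem (hM.mem_of_mem hXM (ht.mem _))
    (hM.mem_of_mem hYM (ht'.mem _))), ?_, fun p hp => ZFSet.mem_union.2 (Or.inl hp)⟩
  rw [isIso_total_iff hbij hg]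
  refine ⟨⟨htrans ht.r_subset ht'.r_subset hf.1, htrans he he' hf.2⟩, fun s hs => ?_,
    fun s hs => ?_⟩
  · rw [tup_mem_funs, tup_mem_funs]
    exact forall_congr' fun j => (hmem _ (hs j)).symm
  · rw [ht.R_eq, ht'.R_eq, tup_map_mem_orb_iff Ξ.γ hbij ht.mem hs]
    simp only [hF't]

end GroupExt

namespace GroupExt

variable {Ξ : GroupExt} {M : Set ZFSet.{u}} {α : Type}

/-! ### The construction defined by a class of bases -/

namespace BaseClass

variable (𝒦 : Ξ.BaseClass M)

/-- The structure `B` extends a member of the class. -/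
def Graph (B : Str.{u}) : Prop :=
  ∃ X ∈ M, ∃ D ∈ M, ∃ r ∈ M, ∃ e ∈ M, ∃ R ∈ M,
    B = Ξ.total X D r e R ∧ 𝒦.K D r e ∧ Ξ.Extends X D r R

theorem exists_formula (hM : IsTransitiveModelZFC M) :
    ∃ φ : ParamFormula M 1, ∀ x, Holds₁ φ x ↔ ∃ B, x = B.code ∧ 𝒦.Graph B := by
  obtain ⟨φ, hφ⟩ := Def.exists_holds₁ (M := M) (p := fun x =>
    ∃ X ∈ M, ∃ D ∈ M, ∃ r ∈ M, ∃ e ∈ M, ∃ R ∈ M,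
      x = (Ξ.total X D r e R).code ∧ 𝒦.K D r e ∧ Ξ.Extends X D r R) <|
    Def.ex <| Def.ex <| Def.ex <| Def.ex <| Def.ex <|
      (Def.eq (.var _) (defF_total hM (.var _) (.var _) (.var _) (.var _) (.var _))).and <|
      (𝒦.definable.reindex ![some (some (some none)), some (some none), some none]).and <|
      def_extends hM (.var _) (.var _) (.var _) (.var _)
  refine ⟨φ, fun x => (hφ x).trans ⟨?_, ?_⟩⟩
  · rintro ⟨_, X, hX, D, hD, r, hr, e, he, R, hR, rfl, h⟩
    exact ⟨_, rfl, X, hX, D, hD, r, hr, e, he, R, hR, rfl, h⟩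
  · rintro ⟨_, rfl, X, hX, D, hD, r, hr, e, he, R, hR, rfl, h⟩
    exact ⟨total_code_mem hM hX hD hr he hR, X, hX, D, hD, r, hr, e, he, R, hR, rfl, h⟩

variable {𝒦}

theorem minus_iff {X D r e R : ZFSet.{u}} {A : Str.{u}} (hK : 𝒦.K D r e)
    (hX : Ξ.Extends X D r R) :
    IsMinus Ξ.lowLang.lang (Ξ.highLang.sym (Sum.inr false)) (Ξ.total X D r e R) A ↔
      A = Ξ.base D r e := by
  obtain ⟨t, ht⟩ := hX
  exact isMinus_total_iff ht.nonempty ht.subset ht.r_subset (𝒦.e_subset _ _ _ hK)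

variable (𝒦)

theorem exists_formula_mem {L : ZFSet.{u}} (hM : IsTransitiveModelZFC M) (hL : L ∈ M) :
    ∃ φ : ParamFormula M 1, ∀ x, Holds₁ φ x ↔ x ∈ L := by
  obtain ⟨φ, hφ⟩ := Def.exists_holds₁ (M := M) (p := fun x => x ∈ L) (Def.mem (.var 0) (.const hL))
  exact ⟨φ, fun x => (hφ x).trans (and_iff_right_of_imp fun h => hM.mem_of_mem hL h)⟩

/-- The data of the construction whose graph consists of all extensions of members of the class. -/
noncomputable def data (hM : IsTransitiveModelZFC M) : ConstructionData M where
  φ₁ := (exists_formula_mem hM (Ξ.highLang.lang_mem hM)).choose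
  φ₂ := (exists_formula_mem hM (Ξ.lowLang.lang_mem hM)).choose
  φ₃ := (𝒦.exists_formula hM).choose
  L := Ξ.highLang.lang
  L' := Ξ.lowLang.lang
  P := Ξ.highLang.sym (Sum.inr false)

variable {𝒦}

theorem holds_φ₃_iff {hM : IsTransitiveModelZFC M} {x : ZFSet.{u}} :
    Holds₁ (𝒦.data hM).φ₃ x ↔ ∃ B, x = B.code ∧ 𝒦.Graph B :=
  (𝒦.exists_formula hM).choose_spec x

theorem inGraph_iff {hM : IsTransitiveModelZFC M} {B : Str.{u}} :
    (𝒦.data hM).InGraph B ↔ 𝒦.Graph B := by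
  refine holds_φ₃_iff.trans ⟨?_, fun h => ⟨B, rfl, h⟩⟩
  rintro ⟨B', h, hB'⟩
  rwa [Str.code_injective h]

/-- No member of the class is lost, because `exists_extends` provides an extension over each of
them. -/
theorem inDomain_iff {hM : IsTransitiveModelZFC M} {A : Str.{u}} :
    (𝒦.data hM).InDomain A ↔
      ∃ D ∈ M, ∃ r ∈ M, ∃ e ∈ M, A = Ξ.base D r e ∧ 𝒦.K D r e := by
  constructor
  · rintro ⟨B, hB, hA⟩
    obtain ⟨X, hX, D, hD, r, hr, e, he, R, hR, rfl, hK, hX⟩ := inGraph_iff.1 hB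
    exact ⟨D, hD, r, hr, e, he, (minus_iff hK hX).1 hA, hK⟩
  · rintro ⟨D, hD, r, hr, e, he, rfl, hK⟩
    obtain ⟨X, hX, R, hR, h⟩ := 𝒦.exists_extends hM hK hD
    exact ⟨_, inGraph_iff.2 ⟨X, hX, D, hD, r, hr, e, he, R, hR, rfl, hK, h⟩, (minus_iff hK h).2 rfl⟩

variable (𝒦)

/-- The construction whose graph consists of all extensions of members of the class. -/
noncomputable def construction (hM : IsTransitiveModelZFC M) : Construction M where
  toConstructionData := 𝒦.data hM
  L_mem := Ξ.highLang.lang_mem hM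
  L'_mem := Ξ.lowLang.lang_mem hM
  L_isLanguage := Ξ.highLang.isLanguage_lang
  L'_isLanguage := Ξ.lowLang.isLanguage_lang
  φ₁_defines := (exists_formula_mem hM (Ξ.highLang.lang_mem hM)).choose_spec
  φ₂_defines := (exists_formula_mem hM (Ξ.lowLang.lang_mem hM)).choose_spec
  L'_subset s hs := by
    obtain ⟨i, rfl⟩ := ZFSet.mem_range.1 hs
    exact Ξ.highLang.sym_mem_lang (Sum.inl i)
  P_mem := Ξ.highLang.sym_mem_lang _
  P_notMem h := by
    obtain ⟨i, hi⟩ := ZFSet.mem_range.1 h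
    exact Sum.inl_ne_inr (Ξ.highLang.sym_injective (a₁ := Sum.inl i) hi)
  P_unary := ⟨num 0, by rw [← num_one]; rfl⟩
  graph_isStr x hx := by
    obtain ⟨B, rfl, X, hX, D, hD, r, hr, e, he, R, hR, rfl, hK, t, ht⟩ := holds_φ₃_iff.1 hx
    exact ⟨_, rfl, isStr_total ⟨_, ht.mem ⟨0, by have := Ξ.n_pos; omega⟩⟩ ht.subset ht.r_subset
      (𝒦.e_subset _ _ _ hK) ht.R_subset⟩
  exists_minus B hB := by
    obtain ⟨X, hX, D, hD, r, hr, e, he, R, hR, rfl, hK, h⟩ := inGraph_iff.1 hB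
    exact ⟨_, (base_code_mem hM).2 ⟨hD, hr, he⟩, (minus_iff hK h).2 rfl⟩
  domain_closed A A' hA hA'M hA' hf := by
    obtain ⟨D, hD, r, hr, e, he, rfl, hK⟩ := inDomain_iff.1 hA
    obtain ⟨r', e', hA'eq, hr', he'⟩ := exists_eq_base hA'
    obtain ⟨f, hfM, hf⟩ := hf
    rw [hA'eq] at hf hA'M ⊢
    obtain ⟨hD'M, hr'M, he'M⟩ := (base_code_mem hM).1 hA'M
    exact inDomain_iff.2 ⟨_, hD'M, r', hr'M, e', he'M, rfl,
      𝒦.iso _ _ _ _ _ _ hK hD hr' he' hD'M f hfM hf⟩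
  extends_iso A B A₀ B₀ hA hB hA₀ hB₀ f hfM hf := by
    obtain ⟨X, hX, D, hD, r, hr, e, he, R, hR, rfl, hK, h⟩ := inGraph_iff.1 hA
    obtain ⟨X', hX', D', hD', r', hr', e', he', R', hR', rfl, hK', h'⟩ := inGraph_iff.1 hB
    obtain rfl := (minus_iff hK h).1 hA₀
    obtain rfl := (minus_iff hK' h').1 hB₀
    exact exists_lift hM h h' (𝒦.e_subset _ _ _ hK) (𝒦.e_subset _ _ _ hK') hX hX' hfM hf

end BaseClass

/-! ### The class of torsors on `n`-element sets -/

variable (Ξ M)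

/-- The domain `D` is enumerated by a tuple that generates `r`, and `e` is empty. -/
def IsFull (D r e : ZFSet.{u}) : Prop :=
  ∃ t : Fin Ξ.n → ZFSet.{u}, Function.Injective t ∧ (∀ i, t i ∈ D) ∧ r = orb Ξ.ρ t ∧
    (∀ x ∈ D, ∃ i, x = t i) ∧ e = ∅

variable {Ξ M}

theorem def_isFull (hM : IsTransitiveModelZFC M) {D r e : (α → M) → ZFSet.{u}} (hD : DefF D)
    (hr : DefF r) (he : DefF e) : Def fun v => Ξ.IsFull (D v) (r v) (e v) := by
  refine (Def.exists_block (p := fun v (t : Fin Ξ.n → ZFSet.{u}) => Function.Injective t ∧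
      (∀ i, t i ∈ D v) ∧ r v = orb Ξ.ρ t ∧ (∀ x ∈ D v, ∃ i, x = t i) ∧ e v = ∅) <|
    (def_injective fun i => .var _).and <|
    (Def.forall_index fun i => Def.mem (.var _) (hD.reindex _)).and <|
    (Def.eq (hr.reindex _) (hM.defF_orb Ξ.ρ fun i => .var _)).and <|
    (Def.allMem (p := fun w x => ∃ i : Fin Ξ.n, x = w (Sum.inr i)) (hD.reindex _) hM.transitive <|
      Def.exists_index fun i => Def.eq (.var _) (.var (some (Sum.inr i)))).and <|
    Def.eq (he.reindex _) (.const hM.empty_mem)).congr fun v => ?_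
  constructor
  · rintro ⟨t, ht⟩
    exact ⟨t, fun i => hM.mem_of_mem (hD.1 v) (ht.2.1 i), ht⟩
  · rintro ⟨t, _, ht⟩
    exact ⟨t, ht⟩

theorem eq_empty_of_isIso {F : ZFSet.{u} → ZFSet.{u}} {D D' e' : ZFSet.{u}} (hF : BijOn F D D')
    (he' : e' ⊆ ZFSet.funs (num 2) D')
    (h : ∀ t : Fin 2 → ZFSet.{u}, (∀ j, t j ∈ D) →
      (tup t ∈ (∅ : ZFSet.{u}) ↔ (tup fun j => F (t j)) ∈ e')) : e' = ∅ := by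
  refine (ZFSet.eq_empty _).2 fun z hz => ?_
  obtain ⟨s, hs, rfl⟩ := exists_tup (he' hz)
  choose s' hs' hFs using fun i => hF.surj _ (hs i)
  obtain rfl : (fun i => F (s' i)) = s := funext hFs
  exact ZFSet.notMem_empty _ ((h s' hs').2 hz)

/-- The class of torsors of enumerations of `n`-element sets. -/
def fullClass (Ξ : GroupExt) (hM : IsTransitiveModelZFC M) : Ξ.BaseClass M where
  K := Ξ.IsFull
  definable := def_isFull hM (.var _) (.var _) (.var _)
  exists_tuple := fun D r e ⟨t, ht, hD, hr, _⟩ => ⟨t, ht, hD, hr⟩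
  e_subset := by
    rintro D r e ⟨t, _, _, _, _, rfl⟩
    exact ZFSet.empty_subset _
  iso := by
    rintro D r e D' r' e' ⟨t, htinj, htD, rfl, hDt, rfl⟩ hD hr' he' hD' f hfM hf
    obtain ⟨F, hF, hfF⟩ := hf.bij.exists_bijOn
    change BijOn F D D' at hF
    rw [isIso_base_iff hF hfF] at hf
    refine ⟨fun i => F (t i), fun i j hij => htinj (hF.inj _ (htD i) _ (htD j) hij),
      fun i => hF.maps _ (htD i), eq_orb_of_map Ξ.ρ hF htD hr' hf.1, fun y hy => ?_,
      eq_empty_of_isIso hF he' hf.2⟩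
    obtain ⟨x, hx, rfl⟩ := hF.surj y hy
    obtain ⟨i, rfl⟩ := hDt x hx
    exact ⟨i, rfl⟩

theorem isFull_num : Ξ.IsFull (num Ξ.n) (orb Ξ.ρ fun i => num.{u} i) ∅ :=
  ⟨fun i => num i, fun _ _ h => Fin.ext (num_injective h), fun i => num_mem_num i.2, rfl,
    fun _ hx => mem_num.1 hx, rfl⟩

theorem orb_num_mem (hM : IsTransitiveModelZFC M) : (orb Ξ.ρ fun i => num i) ∈ M :=
  hM.orb_mem _ fun i => hM.num_mem i

/-- Matching the two generating enumerations entry by entry carries one torsor to the other. -/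
theorem exists_isIso_of_isFull (hM : IsTransitiveModelZFC M) {D r e D' r' e' : ZFSet.{u}}
    (hD : D ∈ M) (hD' : D' ∈ M) (h : Ξ.IsFull D r e) (h' : Ξ.IsFull D' r' e') :
    ∃ f ∈ M, IsIso Ξ.lowLang.lang (Ξ.base D r e) (Ξ.base D' r' e') f := by
  classical
  obtain ⟨t, htinj, htD, rfl, hDt, rfl⟩ := h
  obtain ⟨t', htinj', htD', rfl, hDt', rfl⟩ := h'
  let F : ZFSet.{u} → ZFSet.{u} := fun x => if h : ∃ i, x = t i then t' h.choose else ∅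
  have hF : ∀ i, F (t i) = t' i := fun i => by
    have h : ∃ j, t i = t j := ⟨i, rfl⟩
    simp only [F, dif_pos h]
    rw [← htinj h.choose_spec]
  have hbij : BijOn F D D' := by
    refine ⟨fun x hx => ?_, fun x hx y hy hxy => ?_, fun y hy => ?_⟩
    · obtain ⟨i, rfl⟩ := hDt x hx
      rw [hF]
      exact htD' i
    · obtain ⟨i, rfl⟩ := hDt x hx
      obtain ⟨j, rfl⟩ := hDt y hy
      rw [hF, hF] at hxy
      rw [htinj' hxy]
    · obtain ⟨i, rfl⟩ := hDt' y hy
      exact ⟨t i, htD i, hF i⟩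
  have hgraph : IsGraphOn F D (ZFSet.range fun i => ZFSet.pair (t i) (t' i)) := by
    intro p
    rw [ZFSet.mem_range]
    constructor
    · rintro ⟨i, rfl⟩
      exact ⟨t i, htD i, by rw [hF]⟩
    · rintro ⟨x, hx, rfl⟩
      obtain ⟨i, rfl⟩ := hDt x hx
      exact ⟨i, by rw [hF]⟩
  refine ⟨_, hM.range_mem fun i => hM.pair_mem (hM.mem_of_mem hD (htD i))
    (hM.mem_of_mem hD' (htD' i)), (isIso_base_iff hbij hgraph).2 ⟨fun s hs => ?_, fun s hs => ?_⟩⟩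
  · rw [tup_map_mem_orb_iff Ξ.ρ hbij htD hs]
    simp only [hF]
  · exact iff_of_false (ZFSet.notMem_empty _) (ZFSet.notMem_empty _)

theorem unitype_fullClass (hM : IsTransitiveModelZFC M) :
    ((Ξ.fullClass hM).construction hM).Unitype := by
  refine ⟨⟨_, (BaseClass.inDomain_iff (hM := hM)).2 ⟨_, hM.num_mem _, _, orb_num_mem hM, _, hM.empty_mem, rfl,
    isFull_num⟩⟩, fun A A' hA hA' => ?_⟩
  obtain ⟨D, hD, r, hr, e, he, rfl, h⟩ := (BaseClass.inDomain_iff (hM := hM)).1 hA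
  obtain ⟨D', hD', r', hr', e', he', rfl, h'⟩ := (BaseClass.inDomain_iff (hM := hM)).1 hA'
  exact exists_isIso_of_isFull hM hD hD' h h'

/-! ### The class of copies of transitive sets -/

variable (Ξ M)

/-- The structure `(D, e)` is isomorphic in `M` to `(T, ∈)` for a transitive set `T`. -/
def IsCollapsible (D e : ZFSet.{u}) : Prop :=
  ∃ T ∈ M, ∃ c ∈ M, T.IsTransitive ∧ IsBij D T c ∧ ∀ a ∈ D, ∀ b ∈ D, ∀ a' ∈ T, ∀ b' ∈ T,
    ZFSet.pair a a' ∈ c → ZFSet.pair b b' ∈ c → (tup ![a, b] ∈ e ↔ a' ∈ b')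

/-- A torsor of `n`-tuples in a copy of a transitive set. -/
def IsWellFounded (D r e : ZFSet.{u}) : Prop :=
  (∃ t : Fin Ξ.n → ZFSet.{u}, Function.Injective t ∧ (∀ i, t i ∈ D) ∧ r = orb Ξ.ρ t) ∧
    e ⊆ ZFSet.funs (num 2) D ∧ IsCollapsible M D e

variable {Ξ M}

theorem def_isBij (hM : IsTransitiveModelZFC M) {D E f : (α → M) → ZFSet.{u}} (hD : DefF D)
    (hE : DefF E) (hf : DefF f) : Def fun v => IsBij (D v) (E v) (f v) := by
  refine (Def.and
    (Def.allMem (p := fun v p => ∃ x ∈ D v, ∃ y ∈ E v, p = ZFSet.pair x y) hf hM.transitive <|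
      Def.exMem (hD.reindex _) hM.transitive <|
      Def.exMem (p := fun w y => (w (some none) : ZFSet.{u}) = ZFSet.pair (w none) y)
        ((hE.reindex some).reindex some) hM.transitive <|
      Def.eq (.var _) (hM.defF_pair (.var _) (.var _))) <|
    Def.and
    (Def.allMem (p := fun v x => ∃ y ∈ M, ZFSet.pair x y ∈ f v ∧
        ∀ y' ∈ M, ZFSet.pair x y' ∈ f v → y' = y) hD hM.transitive <|
      Def.ex <| (Def.mem (hM.defF_pair (.var _) (.var _)) (hf.reindex _)).and <|
      Def.all <| (Def.mem (hM.defF_pair (.var _) (.var _)) (hf.reindex _)).imp <|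
      Def.eq (.var _) (.var _))
    (Def.allMem (p := fun v y => ∃ x ∈ M, ZFSet.pair x y ∈ f v ∧
        ∀ x' ∈ M, ZFSet.pair x' y ∈ f v → x' = x) hE hM.transitive <|
      Def.ex <| (Def.mem (hM.defF_pair (.var _) (.var _)) (hf.reindex _)).and <|
      Def.all <| (Def.mem (hM.defF_pair (.var _) (.var _)) (hf.reindex _)).imp <|
      Def.eq (.var _) (.var _))).congr fun v => ?_
  have hp : ∀ {x y}, ZFSet.pair x y ∈ f v → x ∈ M ∧ y ∈ M := fun h =>
    hM.of_pair_mem (hM.mem_of_mem (hf.1 v) h)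
  rw [IsBij, ZFSet.IsFunc, and_assoc]
  refine and_congr ⟨fun h p hp => ZFSet.mem_prod.1 (h hp), fun h p hp => ZFSet.mem_prod.2 (h p hp)⟩
    (and_congr (forall₂_congr fun x _ => ?_) (forall₂_congr fun y _ => ?_))
  · constructor
    · rintro ⟨y, hy, h⟩
      exact ⟨y, (hp hy).2, hy, fun y' _ => h y'⟩
    · rintro ⟨y, _, hy, h⟩
      exact ⟨y, hy, fun y' hy' => h y' (hp hy').2 hy'⟩
  · constructor
    · rintro ⟨x, hx, h⟩
      exact ⟨x, (hp hx).1, hx, fun x' _ => h x'⟩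
    · rintro ⟨x, _, hx, h⟩
      exact ⟨x, hx, fun x' hx' => h x' (hp hx').1 hx'⟩

theorem _root_.NatDef.IsTransitiveModelZFC.defF_tup_two (hM : IsTransitiveModelZFC M)
    {f g : (α → M) → ZFSet.{u}} (hf : DefF f) (hg : DefF g) : DefF fun v => tup ![f v, g v] := by
  have h := hM.defF_tup (f := ![f, g]) (Fin.forall_fin_two.2 ⟨hf, hg⟩)
  convert h using 4 with v i
  fin_cases i <;> rfl

theorem mem_funs_two {D x : ZFSet.{u}} :
    x ∈ ZFSet.funs (num 2) D ↔ ∃ a ∈ D, ∃ b ∈ D, x = tup ![a, b] := by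
  constructor
  · intro h
    obtain ⟨t, ht, rfl⟩ := exists_tup h
    exact ⟨t 0, ht 0, t 1, ht 1, by congr 1; funext i; fin_cases i <;> rfl⟩
  · rintro ⟨a, ha, b, hb, rfl⟩
    exact tup_mem_funs.2 (Fin.forall_fin_two.2 ⟨ha, hb⟩)

theorem def_isCollapsible (hM : IsTransitiveModelZFC M) {D e : (α → M) → ZFSet.{u}} (hD : DefF D)
    (he : DefF e) : Def fun v => IsCollapsible M (D v) (e v) :=
  Def.ex <| Def.ex <| (hM.def_isTransitive (.var _)).and <|
    (def_isBij hM ((hD.reindex some).reindex some) (.var _) (.var _)).and <|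
    Def.allMem ((hD.reindex some).reindex some) hM.transitive <|
    Def.allMem (((hD.reindex some).reindex some).reindex some) hM.transitive <|
    Def.allMem (.var _) hM.transitive <| Def.allMem (.var _) hM.transitive <|
    (Def.mem (hM.defF_pair (.var _) (.var _)) (.var _)).imp <|
    (Def.mem (hM.defF_pair (.var _) (.var _)) (.var _)).imp <|
    (Def.mem (hM.defF_tup_two (.var _) (.var _)) (he.reindex _)).iff (Def.mem (.var _) (.var _))

theorem def_isWellFounded (hM : IsTransitiveModelZFC M) {D r e : (α → M) → ZFSet.{u}}
    (hD : DefF D) (hr : DefF r) (he : DefF e) :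
    Def fun v => Ξ.IsWellFounded M (D v) (r v) (e v) := by
  refine Def.and ?_ <| Def.and ?_ <| def_isCollapsible hM hD he
  · refine (Def.exists_block (p := fun v (t : Fin Ξ.n → ZFSet.{u}) => Function.Injective t ∧
        (∀ i, t i ∈ D v) ∧ r v = orb Ξ.ρ t) <|
      (def_injective fun i => .var _).and <|
      (Def.forall_index fun i => Def.mem (.var _) (hD.reindex _)).and <|
      Def.eq (hr.reindex _) (hM.defF_orb Ξ.ρ fun i => .var _)).congr fun v => ?_
    constructor
    · rintro ⟨t, ht⟩
      exact ⟨t, fun i => hM.mem_of_mem (hD.1 v) (ht.2.1 i), ht⟩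
    · rintro ⟨t, _, ht⟩
      exact ⟨t, ht⟩
  · refine (Def.allMem (p := fun v x => ∃ a ∈ D v, ∃ b ∈ D v, x = tup ![a, b]) he hM.transitive <|
      Def.exMem (hD.reindex _) hM.transitive <|
      Def.exMem (p := fun w b => (w (some none) : ZFSet.{u}) = tup ![(w none : ZFSet.{u}), b])
        ((hD.reindex some).reindex some) hM.transitive <|
      Def.eq (.var _) (hM.defF_tup_two (.var _) (.var _))).congr fun v => ?_
    exact forall₂_congr fun x _ => mem_funs_two

theorem IsCollapsible.exists_collapse {D e : ZFSet.{u}} (h : IsCollapsible M D e) :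
    ∃ T ∈ M, ∃ c ∈ M, ∃ C, T.IsTransitive ∧ BijOn C D T ∧ IsGraphOn C D c ∧
      ∀ a ∈ D, ∀ b ∈ D, (tup ![a, b] ∈ e ↔ C a ∈ C b) := by
  obtain ⟨T, hT, c, hc, htr, hbij, h⟩ := h
  obtain ⟨C, hC, hcC⟩ := hbij.exists_bijOn
  exact ⟨T, hT, c, hc, C, htr, hC, hcC, fun a ha b hb => h a ha b hb _ (hC.maps a ha) _
    (hC.maps b hb) (hcC.pair_mem.2 ⟨ha, rfl⟩) (hcC.pair_mem.2 ⟨hb, rfl⟩)⟩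

theorem isCollapsible_of_collapse {D e T c : ZFSet.{u}} {C : ZFSet.{u} → ZFSet.{u}} (hT : T ∈ M)
    (hc : c ∈ M) (htr : T.IsTransitive) (hC : BijOn C D T) (hcC : IsGraphOn C D c)
    (h : ∀ a ∈ D, ∀ b ∈ D, (tup ![a, b] ∈ e ↔ C a ∈ C b)) : IsCollapsible M D e := by
  refine ⟨T, hT, c, hc, htr, hC.isBij hcC, fun a ha b hb a' _ b' _ hac hbc => ?_⟩
  rw [h a ha b hb, (hcC.pair_mem.1 hac).2, (hcC.pair_mem.1 hbc).2]

theorem tup_two_map (F : ZFSet.{u} → ZFSet.{u}) (a b : ZFSet.{u}) :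
    (tup fun j => F (![a, b] j)) = tup ![F a, F b] := by
  congr 1
  funext j
  fin_cases j <;> rfl

/-- The class of torsors of `n`-tuples in copies of transitive sets. -/
def wellFoundedClass (Ξ : GroupExt) (hM : IsTransitiveModelZFC M) : Ξ.BaseClass M where
  K := Ξ.IsWellFounded M
  definable := def_isWellFounded hM (.var _) (.var _) (.var _)
  exists_tuple := fun _ _ _ h => h.1
  e_subset := fun _ _ _ h => h.2.1
  iso := by
    rintro D r e D' r' e' ⟨⟨t, htinj, htD, rfl⟩, -, hcol⟩ hD hr' he' hD' f hfM hf
    obtain ⟨F, hF, hfF⟩ := hf.bij.exists_bijOn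
    change BijOn F D D' at hF
    change IsGraphOn F D f at hfF
    rw [isIso_base_iff hF hfF] at hf
    refine ⟨⟨fun i => F (t i), fun i j hij => htinj (hF.inj _ (htD i) _ (htD j) hij),
      fun i => hF.maps _ (htD i), eq_orb_of_map Ξ.ρ hF htD hr' hf.1⟩, he', ?_⟩
    obtain ⟨T, hT, c, hc, C, htr, hC, hcC, h⟩ := hcol.exists_collapse
    obtain ⟨F', hF', hl, hr⟩ := hF.exists_inverse
    -- The collapse of the copy is the old collapse composed with `f⁻¹`.
    refine isCollapsible_of_collapse hT (hM.comp_mem hc (hM.inv_mem hfM)) htr (hF'.comp hC)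
      ((hfF.inv hF hl).comp hcC hF'.maps) fun a ha b hb => ?_
    have h₁ := hf.2 ![F' a, F' b] (Fin.forall_fin_two.2 ⟨hF'.maps a ha, hF'.maps b hb⟩)
    rw [tup_two_map, hr a ha, hr b hb, h _ (hF'.maps a ha) _ (hF'.maps b hb)] at h₁
    exact h₁.symm

/-- Uniqueness of the Mostowski collapse: if `C` is the collapse, then so is `C ∘ F`, and
∈-induction on the value `C a` gives `C (F a) = C a`. The torsor plays no part. -/
theorem rigid_of_isCollapsible {D r e f : ZFSet.{u}} (hcol : IsCollapsible M D e)
    (hf : IsIso Ξ.lowLang.lang (Ξ.base D r e) (Ξ.base D r e) f) : f = idOn D := by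
  obtain ⟨F, hF, hfF⟩ := hf.bij.exists_bijOn
  change BijOn F D D at hF
  change IsGraphOn F D f at hfF
  rw [isIso_base_iff hF hfF] at hf
  obtain ⟨T, hT, c, hc, C, htr, hC, hcC, h⟩ := hcol.exists_collapse
  have hE : ∀ a ∈ D, ∀ b ∈ D, (C a ∈ C b ↔ C (F a) ∈ C (F b)) := fun a ha b hb => by
    rw [← h a ha b hb, ← h _ (hF.maps a ha) _ (hF.maps b hb), ← tup_two_map]
    exact hf.2 _ (Fin.forall_fin_two.2 ⟨ha, hb⟩)
  have key : ∀ z, ∀ a ∈ D, C a = z → C (F a) = z := by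
    intro z
    induction z using ZFSet.inductionOn with
    | h z ih =>
    rintro a ha rfl
    ext y
    constructor
    · intro hy
      obtain ⟨b, hb, rfl⟩ := hC.surj y (htr _ (hC.maps _ (hF.maps a ha)) hy)
      obtain ⟨b, hb', rfl⟩ := hF.surj b hb
      have hba := (hE b hb' a ha).2 hy
      rwa [ih _ hba b hb' rfl]
    · intro hy
      obtain ⟨b, hb, rfl⟩ := hC.surj y (htr _ (hC.maps a ha) hy)
      rw [← ih _ hy b hb rfl]
      exact (hE b hb a ha).1 hy
  refine hfF.unique ((isGraphOn_idOn D).congr fun a ha => ?_)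
  exact hC.inj _ (hF.maps a ha) _ ha (key _ a ha rfl)

theorem rigidBased_wellFoundedClass (hM : IsTransitiveModelZFC M) :
    ((Ξ.wellFoundedClass hM).construction hM).RigidBased := by
  intro B A hB hA f _ hf
  obtain ⟨D, hD, r, hr, e, he, rfl, h⟩ := (BaseClass.inDomain_iff (hM := hM)).1 ⟨B, hB, hA⟩
  exact rigid_of_isCollapsible h.2.2 hf

end GroupExt

namespace GroupExt

open scoped commutatorElement

variable {Ξ : GroupExt} {M : Set ZFSet.{u}} {α : Type}

/-! ### Uniformising torsors on arbitrary sets through transitive closures -/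

/-- `e` is the membership relation on `T`, as a set of pairs. -/
def IsMemRel (T e : ZFSet.{u}) : Prop :=
  ∀ z, z ∈ e ↔ ∃ a ∈ T, ∃ b ∈ T, a ∈ b ∧ z = tup ![a, b]

theorem def_isMemRel (hM : IsTransitiveModelZFC M) {T e : (α → M) → ZFSet.{u}} (hT : DefF T)
    (he : DefF e) : Def fun v => IsMemRel (T v) (e v) := by
  refine (Def.all (p := fun v z => z ∈ e v ↔ ∃ a ∈ T v, ∃ b ∈ T v, a ∈ b ∧ z = tup ![a, b]) <|
    (Def.mem (.var _) (he.reindex _)).iff <| Def.exMem (hT.reindex some) hM.transitive <|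
    Def.exMem (p := fun w b => (w none : ZFSet.{u}) ∈ b ∧
      (w (some none) : ZFSet.{u}) = tup ![(w none : ZFSet.{u}), b])
      ((hT.reindex some).reindex some) hM.transitive <|
    (Def.mem (.var _) (.var _)).and <|
    Def.eq (.var _) (hM.defF_tup_two (.var _) (.var _))).congr fun v => ?_
  refine ⟨fun h z _ => h z, fun h z => ⟨fun hz => (h z (hM.mem_of_mem (he.1 v) hz)).1 hz, ?_⟩⟩
  rintro ⟨a, ha, b, hb, hab, rfl⟩
  refine (h _ (hM.tup_mem (Fin.forall_fin_two.2 ⟨?_, ?_⟩))).2 ⟨a, ha, b, hb, hab, rfl⟩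
  · exact hM.mem_of_mem (hT.1 v) ha
  · exact hM.mem_of_mem (hT.1 v) hb

theorem IsMemRel.subset {T e : ZFSet.{u}} (h : IsMemRel T e) : e ⊆ ZFSet.funs (num 2) T := by
  intro z hz
  obtain ⟨a, ha, b, hb, -, rfl⟩ := (h z).1 hz
  exact mem_funs_two.2 ⟨a, ha, b, hb, rfl⟩

theorem IsMemRel.tup_mem_iff {T e a b : ZFSet.{u}} (h : IsMemRel T e) (ha : a ∈ T) (hb : b ∈ T) :
    tup ![a, b] ∈ e ↔ a ∈ b := by
  rw [h]
  constructor
  · rintro ⟨a', _, b', _, hab, h⟩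
    have h' := tup_injective h
    have h₁ : a = a' := congrFun h' 0
    have h₂ : b = b' := congrFun h' 1
    rwa [h₁, h₂]
  · exact fun hab => ⟨a, ha, b, hb, hab, rfl⟩

theorem exists_isMemRel (hM : IsTransitiveModelZFC M) {T : ZFSet.{u}} (hT : T ∈ M) :
    ∃ e ∈ M, IsMemRel T e := by
  -- A 2-tuple from `T` is a subset of `2 × T`, so this power set bounds the separation.
  obtain ⟨Y, hY, h⟩ := hM.powerset _ (hM.prod_mem (hM.num_mem 2) hT)
  have hdef : Def fun v : Fin 1 → M =>
      ∃ a ∈ T, ∃ b ∈ T, a ∈ b ∧ (v 0 : ZFSet.{u}) = tup ![a, b] :=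
    Def.exMem (.const hT) hM.transitive <|
    Def.exMem (p := fun w b => (w none : ZFSet.{u}) ∈ b ∧
      (w (some 0) : ZFSet.{u}) = tup ![(w none : ZFSet.{u}), b]) (.const hT) hM.transitive <|
    (Def.mem (.var _) (.var _)).and <| Def.eq (.var _) (hM.defF_tup_two (.var _) (.var _))
  refine ⟨_, hM.sep_mem (p := fun z => ∃ a ∈ T, ∃ b ∈ T, a ∈ b ∧ z = tup ![a, b]) hdef hY,
    fun z => ?_⟩
  rw [ZFSet.mem_sep, and_iff_right_iff_imp]
  rintro ⟨a, ha, b, hb, hab, rfl⟩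
  have haM := hM.mem_of_mem hT ha
  have hbM := hM.mem_of_mem hT hb
  refine (h _ (hM.tup_mem (Fin.forall_fin_two.2 ⟨haM, hbM⟩))).2 fun w _ hw => ?_
  exact (ZFSet.mem_funs.1 (mem_funs_two.2 ⟨a, ha, b, hb, rfl⟩)).1 hw

/-- The structure `B` is obtained over `A` from the extension that `φ` selects over the transitive
closure of the domain of `A`. -/
def Selects (Ξ : GroupExt) (φ : ParamFormula M 2) (A B : ZFSet.{u}) : Prop :=
  ∃ D ∈ M, ∃ r ∈ M, ∃ T ∈ M, ∃ e ∈ M, ∃ X ∈ M, ∃ R ∈ M, ∃ X' ∈ M,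
    A = (Ξ.base D r ∅).code ∧ IsTC M D T ∧ IsMemRel T e ∧
    Holds₂ φ (Ξ.base T r e).code (Ξ.total X T r e R).code ∧
    (∀ z ∈ M, z ∈ X' ↔ z ∈ D ∨ (z ∈ X ∧ ¬ z ∈ T)) ∧ B = (Ξ.total X' D r ∅ R).code

theorem def_selects (hM : IsTransitiveModelZFC M) (φ : ParamFormula M 2) :
    Def fun v : Fin 2 → M => Ξ.Selects φ (v 0) (v 1) :=
  Def.ex <| Def.ex <| Def.ex <| Def.ex <| Def.ex <| Def.ex <| Def.ex <|
    (Def.eq (.var _) (defF_base hM (.var _) (.var _) (.const hM.empty_mem))).and <|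
    (hM.def_isTC (.var _) (.var _)).and <|
    (def_isMemRel hM (.var _) (.var _)).and <|
    (def_holds₂ φ (defF_base hM (.var _) (.var _) (.var _))
      (defF_total hM (.var _) (.var _) (.var _) (.var _) (.var _))).and <|
    (Def.all <| (Def.mem (.var _) (.var _)).iff <| (Def.mem (.var _) (.var _)).or <|
      (Def.mem (.var _) (.var _)).and (Def.mem (.var _) (.var _)).not).and <|
    Def.eq (.var _) (defF_total hM (.var _) (.var _) (.var _) (.const hM.empty_mem) (.var _))

/-- The elements of `D` are sets, so membership on the transitive closure of `D` supplies a
definable rigidification that the structure itself does not see. The same `r` serves over `D` and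
over the closure, so the extension chosen over the closure restricts to one over `D`. -/
theorem uniformisable_fullClass (hM : IsTransitiveModelZFC M)
    (hu : ((Ξ.wellFoundedClass hM).construction hM).Uniformisable) :
    ((Ξ.fullClass hM).construction hM).Uniformisable := by
  obtain ⟨φ, hφ⟩ := hu
  obtain ⟨ψ, hψ⟩ := Def.exists_holds₂ (def_selects (Ξ := Ξ) hM φ)
  refine ⟨ψ, fun A hA => ?_⟩
  obtain ⟨D, hD, r, hr, e₀, -, rfl, hfull⟩ := (BaseClass.inDomain_iff (hM := hM)).1 hA
  obtain ⟨s, hsinj, hsD, hrs, hDs, rfl⟩ := id hfull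
  obtain ⟨T, hT, hTC⟩ := hM.exists_isTC hD
  obtain ⟨e, he, heT⟩ := exists_isMemRel hM hT
  -- The identity is the collapse of `T`.
  have hwf : Ξ.IsWellFounded M T r e := by
    refine ⟨⟨s, hsinj, fun i => hTC.2.1 (hsD i), hrs⟩, heT.subset, ?_⟩
    exact isCollapsible_of_collapse hT (hM.idOn_mem hT) hTC.1 (BijOn.id T) (isGraphOn_idOn T)
      fun a ha b hb => heT.tup_mem_iff ha hb
  obtain ⟨B, hB, huniq, hgraph, hminus⟩ := hφ (Ξ.base T r e)
    ((BaseClass.inDomain_iff (hM := hM)).2 ⟨T, hT, r, hr, e, he, rfl, hwf⟩)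
  obtain ⟨X, hX, T', hT', r', hr', e', he', R, hR, rfl, hwf', hext⟩ :=
    (BaseClass.inGraph_iff (hM := hM)).1 hgraph
  obtain ⟨rfl, rfl, rfl⟩ := base_inj.1 ((BaseClass.minus_iff hwf' hext).1 hminus)
  obtain ⟨t, ht⟩ := hext
  -- The chosen enumeration is only known to have its lower part in `T`; but that part belongs to
  -- `r`, whose tuples all have entries in `D`.
  have htD : ∀ i, t (Fin.castAdd Ξ.m i) ∈ D := by
    have h₁ : (tup fun i => t (Fin.castAdd Ξ.m i)) ∈ orb Ξ.ρ s := by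
      rw [← hrs, ht.r_eq]
      exact self_mem_orb _ _
    exact tup_mem_funs.1 (orb_subset_funs _ hsD h₁)
  have hnew : ∀ j, t (Fin.natAdd Ξ.n j) ∈ M := fun j => hM.mem_of_mem hX (ht.mem _)
  let X' : ZFSet.{u} := D ∪ ZFSet.range fun j => t (Fin.natAdd Ξ.n j)
  have hX' : X' ∈ M := hM.union_mem hD (hM.range_mem hnew)
  have hmemX' : ∀ z, z ∈ X' ↔ z ∈ D ∨ ∃ j, z = t (Fin.natAdd Ξ.n j) := fun z => by
    simp [X', eq_comm]
  have hmemX : ∀ z, z ∈ X' ↔ z ∈ D ∨ (z ∈ X ∧ ¬ z ∈ T) := fun z => by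
    rw [hmemX']
    refine or_congr_right ⟨?_, ?_⟩
    · rintro ⟨j, rfl⟩
      exact ⟨ht.mem _, ht.high j⟩
    · rintro ⟨hz, hzT⟩
      exact ((ht.mem_iff z).1 hz).resolve_left hzT
  -- The new points avoid `T`, hence also its subset `D`, and the same enumeration and the same `R`
  -- work.
  have hext' : Ξ.Extends X' D r R := ⟨t, ht.inj, htD, fun j hj => ht.high j (hTC.2.1 hj), ht.r_eq,
    ht.R_eq, hmemX'⟩
  refine ⟨Ξ.total X' D r ∅ R, (hψ _ _).2 ⟨(base_code_mem hM).2 ⟨hD, hr, hM.empty_mem⟩,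
    total_code_mem hM hX' hD hr hM.empty_mem hR, D, hD, r, hr, T, hT, e, he, X, hX, R, hR, X', hX',
    rfl, hTC, heT, hB, fun z _ => hmemX z, rfl⟩, fun y hy => ?_,
    (BaseClass.inGraph_iff (hM := hM)).2 ⟨X', hX', D, hD, r, hr, ∅, hM.empty_mem, R, hR, rfl,
      hfull, hext'⟩, (BaseClass.minus_iff (𝒦 := Ξ.fullClass hM) hfull hext').2 rfl⟩
  obtain ⟨-, -, D₁, hD₁, r₁, hr₁, T₁, hT₁, e₁, he₁, X₁, hX₁, R₁, hR₁, X₁', hX₁', hA₁, hTC₁, heT₁,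
    hB₁, hmem₁, rfl⟩ := (hψ _ _).1 hy
  -- Uniqueness: the code of the base fixes `D` and `r`, these fix `T` and `e`, the uniqueness of
  -- the choice made by `φ` fixes `X` and `R`, and then `X'` is determined by its elements.
  obtain ⟨rfl, rfl, -⟩ := base_inj.1 (Str.code_injective hA₁)
  obtain rfl := hTC₁.unique hTC hT₁ hT
  obtain rfl : e₁ = e := by
    ext z
    rw [heT₁ z, heT z]
  obtain ⟨rfl, -, -, -, rfl⟩ := total_inj (Str.code_injective (huniq _ hB₁))
  congr 2
  ext z
  constructor
  · intro hz
    exact (hmemX z).2 ((hmem₁ z (hM.mem_of_mem hX₁' hz)).1 hz)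
  · intro hz
    exact (hmem₁ z (hM.mem_of_mem hX' hz)).2 ((hmemX z).1 hz)

/-! ### Naturality of the rigid-based construction -/

theorem restrict_idOn {X D : ZFSet.{u}} (h : D ⊆ X) : restrict (idOn X) D = idOn D := by
  ext p
  rw [restrict, ZFSet.mem_sep, mem_idOn, mem_idOn]
  constructor
  · rintro ⟨⟨x, _, rfl⟩, y, hy, z, hyz⟩
    obtain ⟨rfl, -⟩ := ZFSet.pair_inj.1 hyz
    exact ⟨x, hy, rfl⟩
  · rintro ⟨x, hx, rfl⟩
    exact ⟨⟨x, h hx, rfl⟩, x, hx, x, rfl⟩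

theorem idOn_mem_autSet {ι : Type} {Λ : RelLang ι} (hM : IsTransitiveModelZFC M) {D : ZFSet.{u}}
    (hD : D ∈ M) (v : ι → ZFSet.{u}) : idOn D ∈ autSet M Λ.lang (Λ.str D v) := by
  refine ZFSet.mem_sep.2 ⟨ZFSet.mem_powerset.2 fun p hp => ?_, hM.idOn_mem hD,
    RelLang.isIso_idOn D v⟩
  obtain ⟨x, hx, rfl⟩ := mem_idOn.1 hp
  exact ZFSet.pair_mem_prod.2 ⟨hx, hx⟩

/-- The automorphism group of the base is trivial, so the constant map to the identity is a
splitting. -/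
theorem natural_wellFoundedClass (hM : IsTransitiveModelZFC M) :
    ((Ξ.wellFoundedClass hM).construction hM).Natural := by
  intro B A hB hA
  obtain ⟨X, hX, D, hD, r, hr, e, he, R, hR, rfl, hK, hext⟩ :=
    (BaseClass.inGraph_iff (hM := hM)).1 hB
  obtain rfl := (BaseClass.minus_iff hK hext).1 hA
  have haut : ∀ h ∈ autSet M Ξ.lowLang.lang (Ξ.base D r e), h = idOn D := fun h hh =>
    rigid_of_isCollapsible hK.2.2 (ZFSet.mem_sep.1 hh).2.2
  have hidX : idOn X ∈ autSet M Ξ.highLang.lang (Ξ.total X D r e R) := idOn_mem_autSet hM hX _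
  have hidD : idOn D ∈ autSet M Ξ.lowLang.lang (Ξ.base D r e) := idOn_mem_autSet hM hD _
  refine ⟨fun _ => idOn X, ⟨fun _ _ => hidX, {ZFSet.pair (idOn D) (idOn X)},
    hM.singleton_mem (hM.pair_mem (hM.idOn_mem hD) (hM.idOn_mem hX)), fun p => ?_⟩,
    fun h hh => ?_, fun _ _ _ _ => ?_⟩
  · rw [ZFSet.mem_singleton]
    constructor
    · rintro rfl
      exact ⟨_, hidD, rfl⟩
    · rintro ⟨h, hh, rfl⟩
      rw [haut h hh]
  · obtain ⟨t, ht⟩ := hext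
    rw [haut h hh]
    exact restrict_idOn ht.subset
  · exact (isGraphOn_idOn X).unique
      ((isGraphOn_idOn X).comp (isGraphOn_idOn X) fun _ h => h)

/-! ### Failure of naturality on numerals -/

section Permutations

variable {k : ℕ}

/-- A permutation of `k` as a set of pairs. -/
noncomputable def permSet (σ : Equiv.Perm (Fin k)) : ZFSet.{u} := tup fun i => num (σ i)

theorem permSet_injective : Function.Injective (permSet.{u} (k := k)) := fun _ _ h =>
  Equiv.ext fun i => Fin.ext (num_injective (congrFun (tup_injective h) i))

theorem pair_mem_permSet {σ : Equiv.Perm (Fin k)} {x y : ZFSet.{u}} :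
    ZFSet.pair x y ∈ permSet σ ↔ ∃ i : Fin k, x = num i ∧ y = num (σ i) :=
  pair_mem_tup

theorem mem_permSet {σ : Equiv.Perm (Fin k)} {p : ZFSet.{u}} :
    p ∈ permSet σ ↔ ∃ i : Fin k, p = ZFSet.pair (num i) (num (σ i)) := by
  simp [permSet, tup, eq_comm]

theorem comp_permSet (σ τ : Equiv.Perm (Fin k)) :
    comp (permSet.{u} σ) (permSet τ) = permSet (σ * τ) := by
  ext p
  rw [mem_comp, mem_permSet]
  constructor
  · rintro ⟨x, y, z, rfl, h₁, h₂⟩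
    obtain ⟨i, rfl, rfl⟩ := pair_mem_permSet.1 h₁
    obtain ⟨j, hj, rfl⟩ := pair_mem_permSet.1 h₂
    rw [← Fin.ext (num_injective hj)]
    exact ⟨i, rfl⟩
  · rintro ⟨i, rfl⟩
    exact ⟨_, num (τ i), _, rfl, pair_mem_permSet.2 ⟨i, rfl, rfl⟩,
      pair_mem_permSet.2 ⟨τ i, rfl, rfl⟩⟩

theorem inv_permSet (σ : Equiv.Perm (Fin k)) : inv (permSet.{u} σ) = permSet σ⁻¹ := by
  ext p
  rw [mem_inv, mem_permSet]
  constructor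
  · rintro ⟨x, y, rfl, h⟩
    obtain ⟨i, rfl, rfl⟩ := pair_mem_permSet.1 h
    exact ⟨σ i, by simp⟩
  · rintro ⟨i, rfl⟩
    exact ⟨_, _, rfl, pair_mem_permSet.2 ⟨σ⁻¹ i, rfl, by simp⟩⟩

theorem permSet_one : permSet.{u} (1 : Equiv.Perm (Fin k)) = idOn (num k) := by
  ext p
  rw [mem_permSet, mem_idOn]
  constructor
  · rintro ⟨i, rfl⟩
    exact ⟨_, num_mem_num i.2, rfl⟩
  · rintro ⟨x, hx, rfl⟩
    obtain ⟨i, rfl⟩ := mem_num.1 hx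
    exact ⟨i, rfl⟩

/-- The letters of the commutator of `f` and `g`. -/
def commWord (f g : ZFSet.{u}) : List (ZFSet.{u} × Bool) :=
  [(f, true), (g, true), (f, false), (g, false)]

theorem wordProd_commWord (σ τ : Equiv.Perm (Fin k)) :
    wordProd (num.{u} k) (commWord (permSet σ) (permSet τ)) = permSet ⁅σ, τ⁆ := by
  simp only [commWord, wordProd, ← permSet_one, inv_permSet, comp_permSet, commutatorElement_def,
    mul_one, mul_assoc]

theorem exists_bijOn_permSet (σ : Equiv.Perm (Fin k)) :
    ∃ F, BijOn F (num.{u} k) (num k) ∧ IsGraphOn F (num k) (permSet σ) ∧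
      ∀ i : Fin k, F (num i) = num (σ i) := by
  obtain ⟨F, hF, hg⟩ := exists_isGraphOn (ZFSet.mem_funs.1
    (tup_mem_funs.2 fun i => num_mem_num (σ i).2 : permSet σ ∈ ZFSet.funs (num k) (num.{u} k)))
  have hFi : ∀ i : Fin k, F (num i) = num (σ i) := fun i =>
    num_pair_mem_tup.1 (hg.pair_mem.2 ⟨num_mem_num i.2, rfl⟩)
  refine ⟨F, ⟨hF, fun x hx y hy hxy => ?_, fun y hy => ?_⟩, hg, hFi⟩
  · obtain ⟨i, rfl⟩ := mem_num.1 hx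
    obtain ⟨j, rfl⟩ := mem_num.1 hy
    rw [hFi, hFi] at hxy
    rw [σ.injective (Fin.ext (num_injective hxy))]
  · obtain ⟨i, rfl⟩ := mem_num.1 hy
    exact ⟨num (σ⁻¹ i : Fin k), num_mem_num (Fin.is_lt _), by rw [hFi]; simp⟩

theorem permSet_mem (hM : IsTransitiveModelZFC M) (σ : Equiv.Perm (Fin k)) : permSet σ ∈ M :=
  hM.tup_mem fun _ => hM.num_mem _

end Permutations

variable (Ξ) in
/-- The base structure on the numeral `n`. -/
noncomputable def numBase : Str.{u} := Ξ.base (num Ξ.n) (orb Ξ.ρ fun i => num i) ∅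

variable (Ξ) in
/-- The extension of `numBase` to the numeral `n + m`. -/
noncomputable def numTotal : Str.{u} :=
  Ξ.total (num (Ξ.n + Ξ.m)) (num Ξ.n) (orb Ξ.ρ fun i => num i) ∅ (orb Ξ.γ fun i => num i)

theorem extends_num : Ξ.Extends (num.{u} (Ξ.n + Ξ.m)) (num Ξ.n) (orb Ξ.ρ fun i => num i)
    (orb Ξ.γ fun i => num i) := by
  refine ⟨fun i => num i, fun _ _ h => Fin.ext (num_injective h), fun i => num_mem_num i.2,
    fun j hj => ?_, rfl, rfl, fun x => ?_⟩
  · obtain ⟨i, hi⟩ := mem_num.1 hj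
    have := num_injective hi
    have := i.2
    simp only [Fin.val_natAdd] at *
    omega
  · constructor
    · intro hx
      obtain ⟨i, rfl⟩ := mem_num.1 hx
      induction i using Fin.addCases with
      | left i => exact Or.inl (num_mem_num i.2)
      | right j => exact Or.inr ⟨j, rfl⟩
    · rintro (hx | ⟨j, rfl⟩)
      · obtain ⟨i, rfl⟩ := mem_num.1 hx
        exact num_mem_num (by have := i.2; omega)
      · exact num_mem_num (Fin.is_lt _)

theorem graph_numTotal (hM : IsTransitiveModelZFC M) :
    (Ξ.fullClass hM).Graph Ξ.numTotal :=
  ⟨_, hM.num_mem _, _, hM.num_mem _, _, orb_num_mem hM, _, hM.empty_mem, _,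
    hM.orb_mem _ fun i => hM.num_mem i, rfl, isFull_num, extends_num⟩

/-- On a numeral the points coincide with the indices, so `ρ h` moves the base tuple to its own
translate and preserves the torsor. -/
theorem permSet_mem_autSet (hM : IsTransitiveModelZFC M) (h : Ξ.H) :
    permSet (Ξ.ρ h) ∈ autSet M Ξ.lowLang.lang Ξ.numBase := by
  obtain ⟨F, hF, hg, hFi⟩ := exists_bijOn_permSet.{u} (Ξ.ρ h)
  refine ZFSet.mem_sep.2 ⟨ZFSet.mem_powerset.2 (hF.isBij hg).1.1, permSet_mem hM _, ?_⟩
  refine (isIso_base_iff hF hg).2 ⟨fun t ht => ?_,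
    fun t _ => iff_of_false (ZFSet.notMem_empty _) (ZFSet.notMem_empty _)⟩
  rw [tup_map_mem_orb_iff Ξ.ρ hF (fun i => num_mem_num i.2) ht]
  simp only [hFi]
  rw [orb_translate Ξ.ρ fun i => num i]

/-- An automorphism sends the standard enumeration, which belongs to `R`, to another tuple of `R`.
Since the enumeration exhausts the domain, this determines the automorphism. -/
theorem exists_eq_permSet {f : ZFSet.{u}} (hf : f ∈ autSet M Ξ.highLang.lang Ξ.numTotal) :
    ∃ g, f = permSet (Ξ.γ g) := by
  have hiso := (ZFSet.mem_sep.1 hf).2.2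
  obtain ⟨F, hF, hfF⟩ := hiso.bij.exists_bijOn
  change BijOn F (num _) (num _) at hF
  change IsGraphOn F (num _) f at hfF
  have h := (((isIso_total_iff hF hfF).1 hiso).2.2 (fun i => num i)
    fun i => num_mem_num i.2).1 (self_mem_orb _ _)
  obtain ⟨g, hg⟩ := (tup_mem_orb Ξ.γ).1 h
  refine ⟨g, ?_⟩
  ext p
  rw [hfF, mem_permSet]
  constructor
  · rintro ⟨x, hx, rfl⟩
    obtain ⟨i, rfl⟩ := mem_num.1 hx
    exact ⟨i, by rw [← congrFun hg i]⟩
  · rintro ⟨i, rfl⟩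
    exact ⟨_, num_mem_num i.2, by rw [← congrFun hg i]⟩

theorem restrict_permSet (g : Ξ.G) :
    restrict (permSet.{u} (Ξ.γ g)) (num Ξ.n) = permSet (Ξ.ρ (Ξ.ν g)) := by
  ext p
  rw [restrict, ZFSet.mem_sep, mem_permSet, mem_permSet]
  constructor
  · rintro ⟨⟨i, rfl⟩, x, hx, y, hxy⟩
    obtain ⟨rfl, -⟩ := ZFSet.pair_inj.1 hxy
    obtain ⟨j, hj⟩ := mem_num.1 hx
    obtain rfl : i = Fin.castAdd Ξ.m j := Fin.ext (num_injective hj)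
    exact ⟨j, by rw [Ξ.γ_castAdd]; rfl⟩
  · rintro ⟨i, rfl⟩
    exact ⟨⟨Fin.castAdd Ξ.m i, by rw [Ξ.γ_castAdd]; rfl⟩, _, num_mem_num i.2, _, rfl⟩

/-- No choice of lifts of suitable elements `a`, `b`, `c` of `H` makes the relators `[a, b]` and
`[a, c]` commute. -/
def NotWeaklySplit (Ξ : GroupExt) : Prop :=
  ∃ a b c : Ξ.H, Commute a b ∧ Commute a c ∧ ∀ a' b' c' : Ξ.G,
    Ξ.ν a' = a → Ξ.ν b' = b → Ξ.ν c' = c → ¬ Commute ⁅a', b'⁆ ⁅a', c'⁆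

/-- Translates a section of the restriction map into a choice of preimages under `ν`; faithfulness
of `ρ` identifies the image of the lift. -/
theorem exists_lift_of_section {s : ZFSet.{u} → ZFSet.{u}} (hM : IsTransitiveModelZFC M)
    (hs : IsMapIn M (autSet M Ξ.lowLang.lang Ξ.numBase) (autSet M Ξ.highLang.lang Ξ.numTotal) s)
    (hres : ∀ h ∈ autSet M Ξ.lowLang.lang Ξ.numBase, restrict (s h) Ξ.numBase.dom = h) (h : Ξ.H) :
    ∃ g, s (permSet (Ξ.ρ h)) = permSet (Ξ.γ g) ∧ Ξ.ν g = h := by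
  have hmem := permSet_mem_autSet hM h
  obtain ⟨g, hg⟩ := exists_eq_permSet (hs.1 _ hmem)
  refine ⟨g, hg, ?_⟩
  have := hres _ hmem
  rw [hg] at this
  exact Ξ.ρ_injective (permSet_injective ((restrict_permSet g).symm.trans this))

/-- A homomorphic section lifts the commuting pair `a, b` to a commuting pair, so `[a', b']` is
trivial and commutes with everything. -/
theorem not_natural_fullClass (hM : IsTransitiveModelZFC M) (hΞ : Ξ.NotWeaklySplit) :
    ¬ ((Ξ.fullClass hM).construction hM).Natural := by
  intro hnat
  obtain ⟨a, b, c, hab, hac, hlift⟩ := hΞ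
  obtain ⟨s, hs, hres, hmul⟩ := hnat Ξ.numTotal Ξ.numBase
    ((BaseClass.inGraph_iff (hM := hM)).2 (graph_numTotal hM))
    ((BaseClass.minus_iff (𝒦 := Ξ.fullClass hM) isFull_num extends_num).2 rfl)
  obtain ⟨a', ha', hνa⟩ := exists_lift_of_section hM hs hres a
  obtain ⟨b', hb', hνb⟩ := exists_lift_of_section hM hs hres b
  obtain ⟨c', -, hνc⟩ := exists_lift_of_section hM hs hres c
  refine hlift a' b' c' hνa hνb hνc ?_
  have h₁ := hmul _ (permSet_mem_autSet hM a) _ (permSet_mem_autSet hM b)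
  have h₂ := hmul _ (permSet_mem_autSet hM b) _ (permSet_mem_autSet hM a)
  rw [comp_permSet, ← map_mul, ha', hb', comp_permSet, ← map_mul] at h₁ h₂
  rw [hab.eq, h₂] at h₁
  have h₃ : a' * b' = b' * a' := (Ξ.γ_injective (permSet_injective h₁)).symm
  rw [commutatorElement_eq_one_iff_mul_comm.2 h₃]
  exact Commute.one_left _

theorem not_weaklyNatural_fullClass (hM : IsTransitiveModelZFC M) (hΞ : Ξ.NotWeaklySplit) :
    ¬ ((Ξ.fullClass hM).construction hM).WeaklyNatural := by
  intro hnat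
  obtain ⟨a, b, c, hab, hac, hlift⟩ := hΞ
  obtain ⟨s, hs, hres, G₀, -, hG₀, hword⟩ := hnat Ξ.numTotal Ξ.numBase
    ((BaseClass.inGraph_iff (hM := hM)).2 (graph_numTotal hM))
    ((BaseClass.minus_iff (𝒦 := Ξ.fullClass hM) isFull_num extends_num).2 rfl)
  obtain ⟨a', ha', hνa⟩ := exists_lift_of_section hM hs hres a
  have key : ∀ x, Commute a x → ∃ x', Ξ.ν x' = x ∧ permSet (Ξ.γ ⁅a', x'⁆) ∈ G₀ := by
    intro x hax
    obtain ⟨x', hx', hνx⟩ := exists_lift_of_section hM hs hres x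
    refine ⟨x', hνx, ?_⟩
    -- The commutator word is trivial in `H`, so its value on the chosen lifts lies in `G₀`. The
    -- lift `a'` is the same for both choices of `x`, as `NotWeaklySplit` requires.
    have h := hword (commWord (permSet (Ξ.ρ a)) (permSet (Ξ.ρ x))) (fun p hp => ?_) ?_
    · change wordProd (num (Ξ.n + Ξ.m))
        (commWord (s (permSet (Ξ.ρ a))) (s (permSet (Ξ.ρ x)))) ∈ G₀ at h
      rwa [ha', hx', wordProd_commWord, ← map_commutatorElement] at h
    · simp only [commWord, List.mem_cons, List.not_mem_nil, or_false] at hp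
      rcases hp with rfl | rfl | rfl | rfl <;> exact permSet_mem_autSet hM _
    · change wordProd (num Ξ.n) _ = idOn (num Ξ.n)
      rw [wordProd_commWord, ← map_commutatorElement,
        commutatorElement_eq_one_iff_mul_comm.2 hax.eq, map_one, permSet_one]
  obtain ⟨b', hνb, hb'⟩ := key b hab
  obtain ⟨c', hνc, hc'⟩ := key c hac
  refine hlift a' b' c' hνa hνb hνc ?_
  have h := hG₀.comm _ hb' _ hc'
  rw [comp_permSet, comp_permSet, ← map_mul, ← map_mul] at h
  exact Ξ.γ_injective (permSet_injective h)

end GroupExt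

/-! ### A group extension that does not split weakly -/

namespace GroupExt

/-- The regular actions attached to a surjection of finite groups. -/
noncomputable def ofSurjective {G H : Type} [Group G] [Group H] [Finite G] [Finite H] (ν : G →* H)
    (hν : Function.Surjective ν) : GroupExt where
  n := Nat.card H
  m := Nat.card G
  G := G
  H := H
  ν := ν
  ν_surjective := hν
  ρ := (Finite.equivFin H).permCongrHom.toMonoidHom.comp (MulAction.toPermHom H H)
  -- `G` acts on the old points through `ν` and on the new points by its regular action; the latter
  -- makes `γ` faithful.
  γ := finSumFinEquiv.permCongrHom.toMonoidHom.comp <| (Equiv.Perm.sumCongrHom _ _).comp <|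
    (((Finite.equivFin H).permCongrHom.toMonoidHom.comp (MulAction.toPermHom H H)).comp ν).prod
      ((Finite.equivFin G).permCongrHom.toMonoidHom.comp (MulAction.toPermHom G G))
  ρ_injective := (Finite.equivFin H).permCongrHom.injective.comp MulAction.toPerm_injective
  γ_injective := finSumFinEquiv.permCongrHom.injective.comp <|
    Equiv.Perm.sumCongrHom_injective.comp fun _ _ h => MulAction.toPerm_injective
      ((Finite.equivFin G).permCongrHom.injective (Prod.ext_iff.1 h).2)
  γ_castAdd g i := by simp [Equiv.permCongrHom, Equiv.permCongr_apply]
  γ_natAdd g j := ⟨(Finite.equivFin G) (g * (Finite.equivFin G).symm j), by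
    simp [Equiv.permCongrHom, Equiv.permCongr_apply]⟩
  n_pos := Nat.card_pos

end GroupExt

/-- The Heisenberg group over the field with two elements. -/
@[ext]
structure Heis where
  x : ZMod 2
  y : ZMod 2
  z : ZMod 2

namespace Heis

/-- Multiplication of upper unitriangular 3 × 3 matrices with superdiagonal `x`, `y` and corner `z`.
-/
instance : Mul Heis := ⟨fun a b => ⟨a.x + b.x, a.y + b.y, a.z + b.z + a.x * b.y⟩⟩
instance : One Heis := ⟨⟨0, 0, 0⟩⟩
instance : Inv Heis := ⟨fun a => ⟨-a.x, -a.y, -a.z + a.x * a.y⟩⟩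

@[simp] theorem mul_x (a b : Heis) : (a * b).x = a.x + b.x := rfl
@[simp] theorem mul_y (a b : Heis) : (a * b).y = a.y + b.y := rfl
@[simp] theorem mul_z (a b : Heis) : (a * b).z = a.z + b.z + a.x * b.y := rfl
@[simp] theorem one_x : (1 : Heis).x = 0 := rfl
@[simp] theorem one_y : (1 : Heis).y = 0 := rfl
@[simp] theorem one_z : (1 : Heis).z = 0 := rfl
@[simp] theorem inv_x (a : Heis) : a⁻¹.x = -a.x := rfl
@[simp] theorem inv_y (a : Heis) : a⁻¹.y = -a.y := rfl
@[simp] theorem inv_z (a : Heis) : a⁻¹.z = -a.z + a.x * a.y := rfl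

instance : Group Heis := Group.ofLeftAxioms
  (fun a b c => by ext <;> simp <;> ring) (fun a => by ext <;> simp)
  (fun a => by ext <;> simp only [mul_x, mul_y, mul_z, one_x, one_y, one_z, inv_x, inv_y, inv_z] <;>
    ring)

instance : Finite Heis :=
  Finite.of_injective (fun a => (a.x, a.y, a.z)) fun a b h => by
    simp only [Prod.mk.injEq] at h
    exact Heis.ext h.1 h.2.1 h.2.2

end Heis

/-- The wreath product of the Heisenberg group with the group of two elements. -/
@[ext]
structure WreathHeis where
  s : ZMod 2
  f : ZMod 2 → Heis

namespace WreathHeis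

open scoped commutatorElement

/-- The shift of the right factor acts on the coordinates of the left factor. -/
instance : Mul WreathHeis := ⟨fun a b => ⟨a.s + b.s, fun i => a.f (i + b.s) * b.f i⟩⟩
instance : One WreathHeis := ⟨⟨0, 1⟩⟩
instance : Inv WreathHeis := ⟨fun a => ⟨-a.s, fun i => (a.f (i - a.s))⁻¹⟩⟩

@[simp] theorem mul_s (a b : WreathHeis) : (a * b).s = a.s + b.s := rfl
@[simp] theorem mul_f (a b : WreathHeis) (i : ZMod 2) : (a * b).f i = a.f (i + b.s) * b.f i := rfl
@[simp] theorem one_s : (1 : WreathHeis).s = 0 := rfl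
@[simp] theorem one_f (i : ZMod 2) : (1 : WreathHeis).f i = 1 := rfl
@[simp] theorem inv_s (a : WreathHeis) : a⁻¹.s = -a.s := rfl
@[simp] theorem inv_f (a : WreathHeis) (i : ZMod 2) : a⁻¹.f i = (a.f (i - a.s))⁻¹ := rfl

theorem ext_apply {a b : WreathHeis} (hs : a.s = b.s) (hf : ∀ i, a.f i = b.f i) : a = b :=
  WreathHeis.ext hs (funext hf)

instance : Group WreathHeis := Group.ofLeftAxioms
  (fun a b c => ext_apply (by simp [add_assoc]) fun i => by
    simp only [mul_f, mul_s, mul_assoc]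
    rw [add_assoc, add_comm c.s])
  (fun a => ext_apply (by simp) fun i => by simp)
  (fun a => ext_apply (neg_add_cancel a.s) fun i => by simp)

instance : Finite WreathHeis :=
  Finite.of_injective (fun a => (a.s, a.f)) fun a b h => by
    simp only [Prod.mk.injEq] at h
    exact WreathHeis.ext h.1 h.2

/-- The abelianisation of the wreath product. -/
def toAb : WreathHeis →* Multiplicative (ZMod 2 × ZMod 2 × ZMod 2) where
  toFun a := .ofAdd (a.s, ∑ i, (a.f i).x, ∑ i, (a.f i).y)
  map_one' := by simp
  map_mul' a b := by
    -- Summing over both coordinates makes the shift invisible.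
    have hx := Equiv.sum_comp (Equiv.addRight b.s) fun i => (a.f i).x
    have hy := Equiv.sum_comp (Equiv.addRight b.s) fun i => (a.f i).y
    simp only [Equiv.coe_addRight] at hx hy
    rw [← ofAdd_add]
    simp [Finset.sum_add_distrib, hx, hy]

theorem toAb_eq_ofAdd_iff {a : WreathHeis} {s p q : ZMod 2} :
    toAb a = .ofAdd (s, p, q) ↔
      a.s = s ∧ (a.f 0).x + (a.f 1).x = p ∧ (a.f 0).y + (a.f 1).y = q := by
  have hsum : ∀ f : ZMod 2 → ZMod 2, ∑ i, f i = f 0 + f 1 := fun f => Fin.sum_univ_two f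
  simp only [toAb, MonoidHom.coe_mk, OneHom.coe_mk, EmbeddingLike.apply_eq_iff_eq, Prod.mk.injEq,
    hsum]

theorem toAb_surjective : Function.Surjective toAb := by
  intro h
  obtain ⟨⟨s, p, q⟩, rfl⟩ := Multiplicative.ofAdd.surjective h
  exact ⟨⟨s, fun i => if i = 0 then ⟨p, q, 0⟩ else 1⟩, toAb_eq_ofAdd_iff.2 (by simp)⟩

/-- Modulo the centre of `Heis`, coordinate 0 of the commutator is the difference of the two
coordinates of `b`. In characteristic two this is their sum, which `toAb b` records, so the choice
of lifts does not matter. -/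
theorem commutator_components {a b : WreathHeis} {p q : ZMod 2}
    (ha : a.s = 1) (hb : toAb b = .ofAdd (0, p, q)) :
    ⁅a, b⁆.s = 0 ∧ (⁅a, b⁆.f 0).x = p ∧ (⁅a, b⁆.f 0).y = q := by
  obtain ⟨hs, rfl, rfl⟩ := toAb_eq_ofAdd_iff.1 hb
  have h : ⁅a, b⁆ * (b * a) = a * b := by rw [commutatorElement_def]; group
  -- Coordinate 1 is read off because the shift of `b * a` is 1, which brings in the commutator at
  -- `1 + 1 = 0`.
  have hf := congrArg (fun c => c.f 1) h
  have h11 : (1 + 1 : ZMod 2) = 0 := rfl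
  simp only [mul_f, mul_s, ha, hs, zero_add, add_zero, h11] at hf
  have hx := congrArg Heis.x hf
  have hy := congrArg Heis.y hf
  simp only [Heis.mul_x, Heis.mul_y] at hx hy
  have h2 : ∀ c : ZMod 2, c + c = 0 := by decide
  refine ⟨by simp only [commutatorElement_def, mul_s, inv_s]; ring, ?_, ?_⟩
  · linear_combination hx - h2 (b.f 0).x
  · linear_combination hy - h2 (b.f 0).y

/-- At coordinate 0 the commutators have `(x, y)` equal to `(1, 0)` and `(0, 1)`. Their two products
differ by 1 in the corner entry, through the term `a.x * b.y`. -/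
theorem not_commute_commutators {a b c : WreathHeis} (ha : toAb a = .ofAdd (1, 0, 0))
    (hb : toAb b = .ofAdd (0, 1, 0)) (hc : toAb c = .ofAdd (0, 0, 1)) :
    ¬ Commute ⁅a, b⁆ ⁅a, c⁆ := by
  intro hcomm
  have ha' := (toAb_eq_ofAdd_iff.1 ha).1
  obtain ⟨hs, hx, hy⟩ := commutator_components ha' hb
  obtain ⟨hs', hx', hy'⟩ := commutator_components ha' hc
  have h := congrArg (fun d => (d.f 0).z) hcomm.eq
  simp only [mul_f, hs, hs', add_zero, Heis.mul_z, hx, hy, hx', hy', mul_one, mul_zero] at h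
  rw [add_comm (⁅a, c⁆.f 0).z] at h
  exact one_ne_zero (add_eq_left.1 h)

theorem notWeaklySplit : (GroupExt.ofSurjective toAb toAb_surjective).NotWeaklySplit :=
  ⟨Multiplicative.ofAdd ((1, 0, 0) : ZMod 2 × ZMod 2 × ZMod 2),
    Multiplicative.ofAdd ((0, 1, 0) : ZMod 2 × ZMod 2 × ZMod 2),
    Multiplicative.ofAdd ((0, 0, 1) : ZMod 2 × ZMod 2 × ZMod 2),
    Commute.all (S := Multiplicative (ZMod 2 × ZMod 2 × ZMod 2)) _ _,
    Commute.all (S := Multiplicative (ZMod 2 × ZMod 2 × ZMod 2)) _ _,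
    fun _ _ _ ha hb hc => not_commute_commutators ha hb hc⟩

end WreathHeis

end NatDef

theorem theorem2 (M : Set ZFSet.{u}) (hM : NatDef.IsTransitiveModelZFC M) :
    ¬ ((∀ C : NatDef.Construction M, C.RigidBased → C.Uniformisable) ∧
        (∀ C : NatDef.Construction M, C.Unitype → C.Uniformisable → C.WeaklyNatural)) ∧
    ¬ (∀ C : NatDef.Construction M, C.Natural ↔ C.Uniformisable) := by
  have hΞ := NatDef.WreathHeis.notWeaklySplit
  constructor
  · rintro ⟨ha, hb⟩
    exact NatDef.GroupExt.not_weaklyNatural_fullClass hM hΞ <|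
      hb _ (NatDef.GroupExt.unitype_fullClass hM) <|
      NatDef.GroupExt.uniformisable_fullClass hM <|
      ha _ (NatDef.GroupExt.rigidBased_wellFoundedClass hM)
  · intro h
    exact NatDef.GroupExt.not_natural_fullClass hM hΞ <| (h _).2 <|
      NatDef.GroupExt.uniformisable_fullClass hM <| (h _).1 <|
      NatDef.GroupExt.natural_wellFoundedClass hM
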